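/- Let $\mathcal U=[-1,1]^{\mathbb N}$ carry the uniform (infinite product) probability measure $\varrho$. For $\rho\ge 1$ let $\mathcal E(\rho)=\{(z+z^{-1})/2 : z\in\mathbb C,\ 1\le|z|\le\rho\}$ be the Bernstein ellipse (so $\mathcal E(1)=[-1,1]$), and for $\boldsymbol b\in[0,\infty)^{\mathbb N}$ let $$\mathcal R(\boldsymbol b)=\bigcup\Big\{\prod_{j}\mathcal E(\rho_j) : \rho_j\ge 1\ \forall j,\ \sum_{j=1}^{\infty}\Big(\tfrac{\rho_j+\rho_j^{-1}}{2}-1\Big)b_j\le 1\Big\}\subset\mathbb C^{\mathbb N}.$$ Let $\mathcal H(\boldsymbol b)$ be the set of functions $f:\mathcal U\to\mathbb R$ that have a complex-valued extension which is complex differentiable with respect to each variable at every point of $\mathcal R(\boldsymbol b)$ and is bounded by $1$ in absolute value on $\mathcal R(\boldsymbol b)$. For a set $\Theta\subset\mathbb N$ with $|\Theta|=s$ let $\mathcal T_\Theta(\boldsymbol y)=(y_i)_{i\in\Theta}\in\mathbb R^s$. A tanh DNN $\Phi:\mathbb R^{n}\to\mathbb R^{k}$ is a map $\Phi=\mathcal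 A_{D+1}\circ\tanh\circ\mathcal A_D\circ\cdots\circ\tanh\circ\mathcal A_0$ with affine $\mathcal A_l:\mathbb R^{N_l}\to\mathbb R^{N_{l+1}}$, $N_0=n$, $N_{D+2}=k$, and $\tanh$ acting componentwise. The class $\mathcal N$ of all such maps with a fixed architecture $(D;N_1,\dots,N_{D+1})$ has width $\max\{N_1,\dots,N_{D+1}\}$ and depth $D$. Theorem (existence theorem for DNNs). There are universal constants $c_1,c_2>0$ such that the following holds. Let $0<p<1$ and let $\boldsymbol b\in[0,\infty)^{\mathbb N}$ with $\boldsymbol b\in\ell^p(\mathbb N)$. Then there is a constant $C(\boldsymbol b,p)$ such that for every $s\in\mathbb N=\{1,2,\dots\}$ there are a set $\Theta\subset\mathbb N$ with $|\Theta|=s$ and a class $\mathcal N$ of tanh DNNs $\Phi:\mathbb R^s\to\mathbb R$ of a fixed architecture with $$\mathrm{width}(\mathcal N)\le c_1 s^2,\qquad \mathrm{depth}(\mathcal N)\le c_2\log s,$$ such that for every ($\varrho$-measurable) $f\in\mathcal H(\boldsymbol b)$ there is a $\Phi\in\mathcal N$ with $$\|f-\Phi\circ\mathcal T_\Theta\|_{L^2_\varrho(\mathcal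 U)}\le C(\boldsymbol b,p)\, s^{\frac12-\frac1p}.$$ If, moreover, the minimal monotone majorant $\tilde b_i=\sup_{j\ge i}|b_j|$ of $\boldsymbol b$ belongs to $\ell^p(\mathbb N)$, then $\Theta=\{1,\dots,s\}$, that is, $\mathcal T_\Theta$ is the restriction to the first $s$ coordinates. -/

import Mathlib

open MeasureTheory Set
open scoped ENNReal

noncomputable section

namespace HoloDNN

/-! ### The parameter domain and its uniform probability measure -/

/-- The domain `[-1,1]^ℕ`. -/
abbrev Cube : Type := ℕ → Icc (-1 : ℝ) 1

/-- The uniform probability measure on `[-1,1]`. -/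
def unif : Measure (Icc (-1 : ℝ) 1) :=
  (2 : ℝ≥0∞)⁻¹ • (volume : Measure ℝ).comap Subtype.val

instance : IsProbabilityMeasure unif := by
  constructor
  have h : (volume : Measure ℝ).comap (Subtype.val : Icc (-1 : ℝ) 1 → ℝ) univ = 2 := by
    rw [comap_subtype_coe_apply measurableSet_Icc, image_univ, Subtype.range_coe, Real.volume_Icc]
    norm_num
  rw [unif, Measure.smul_apply, h, smul_eq_mul]
  exact ENNReal.inv_mul_cancel (by norm_num) (by norm_num)

/-- The uniform probability measure on `[-1,1]^ℕ`. -/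
def rho : Measure Cube := Measure.infinitePi fun _ => unif

/-! ### Holomorphic functions of infinitely many variables -/

/-- `F` is holomorphic with respect to each variable at every point of `O`: for all `z ∈ O` and
all `j`, the limit of `(F (z + h e_j) - F z) / h` as `h → 0`, `h ∈ ℂ`, exists. -/
def HolomorphicIn (O : Set (ℕ → ℂ)) (F : (ℕ → ℂ) → ℂ) : Prop :=
  ∀ z ∈ O, ∀ j : ℕ, DifferentiableAt ℂ (fun h : ℂ => F (z + Pi.single j h)) 0

/-- The Bernstein ellipse with parameter `r ≥ 1`; for `r = 1` it is the segment `[-1,1]`. -/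
def bernsteinEllipse (r : ℝ) : Set ℂ :=
  {w | ∃ z : ℂ, 1 ≤ ‖z‖ ∧ ‖z‖ ≤ r ∧ w = (z + z⁻¹) / 2}

/-- The Bernstein polyellipse, a product of Bernstein ellipses. -/
def polyellipse (r : ℕ → ℝ) : Set (ℕ → ℂ) :=
  {w | ∀ j, w j ∈ bernsteinEllipse (r j)}

/-- The union of all polyellipses with parameter `r ≥ 1` such that
`∑ j, ((r j + 1 / r j) / 2 - 1) * b j` converges and is at most `ε`. -/
def region (b : ℕ → ℝ) (ε : ℝ) : Set (ℕ → ℂ) :=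
  {w | ∃ r : ℕ → ℝ, (∀ j, 1 ≤ r j) ∧
    Summable (fun j => ((r j + (r j)⁻¹) / 2 - 1) * b j) ∧
    ∑' j, ((r j + (r j)⁻¹) / 2 - 1) * b j ≤ ε ∧
    w ∈ polyellipse r}

/-- The class of real-valued functions on `[-1,1]^ℕ` that have a complex-valued extension which
is holomorphic in `region b 1` and bounded there by one in absolute value.

The extension is a function on `ℂ^ℕ` of which only its values along coordinate lines near points
of `region b 1` matter. A function that is holomorphic in an open neighbourhood of the region, for
any topology on `ℂ^ℕ` in which coordinate lines are continuous, is of this kind. -/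
def unitClass (b : ℕ → ℝ) : Set (Cube → ℝ) :=
  {f | ∃ F : (ℕ → ℂ) → ℂ, HolomorphicIn (region b 1) F ∧
    (∀ y : Cube, F (fun j => ((y j : ℝ) : ℂ)) = (f y : ℂ)) ∧
    ∀ z ∈ region b 1, ‖F z‖ ≤ 1}

/-! ### The monotone `ℓ^p` space -/

/-- The minimal monotone majorant `i ↦ sup_{j ≥ i} |z j|` of a bounded sequence. -/
def monotoneMajorant (z : ℕ → ℝ) (i : ℕ) : ℝ := ⨆ j : Ici i, |z j|

/-- `z` is bounded and its minimal monotone majorant is in `ℓ^p`. -/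
def MemMonotoneLp (z : ℕ → ℝ) (p : ℝ) : Prop :=
  Memℓp z ∞ ∧ Memℓp (monotoneMajorant z) (ENNReal.ofReal p)

/-! ### Feedforward neural networks -/

/-- The functions `ℝ^n → ℝ^k` of the form `A_{D+1} ∘ σ ∘ A_D ∘ σ ∘ ⋯ ∘ σ ∘ A_0`, where the `A_l` are
affine, `σ` acts componentwise, and the list holds the widths of the hidden layers in order. -/
def realizations (σ : ℝ → ℝ) (k : ℕ) : (n : ℕ) → List ℕ → Set ((Fin n → ℝ) → (Fin k → ℝ))
  | n, [] => {Φ | ∃ A : (Fin n → ℝ) →ᵃ[ℝ] (Fin k → ℝ), Φ = A}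
  | n, N :: L => {Φ | ∃ A : (Fin n → ℝ) →ᵃ[ℝ] (Fin N → ℝ), ∃ Ψ ∈ realizations σ k N L,
      Φ = fun z => Ψ (fun i => σ (A z i))}

/-- An architecture: the positive widths `N_1, …, N_{D+1}` of the hidden layers, `D ≥ 0`. -/
structure Architecture where
  hidden : List ℕ
  ne_nil : hidden ≠ []
  pos : ∀ N ∈ hidden, 0 < N

/-- `max {N_1, …, N_{D+1}}`. -/
def Architecture.width (a : Architecture) : ℕ := a.hidden.foldr max 0

/-- The number `D`, one less than the number of hidden layers. -/
def Architecture.depth (a : Architecture) : ℕ := a.hidden.length - 1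

/-- The class of tanh networks `ℝ^n → ℝ^k` with a given architecture. -/
def tanhDNN (n k : ℕ) (a : Architecture) : Set ((Fin n → ℝ) → (Fin k → ℝ)) :=
  realizations Real.tanh k n a.hidden

/-- The variable restriction operator `y ↦ (y_i)_{i ∈ Θ}`, the indices in increasing order. -/
def restrictVars (Θ : Finset ℕ) {n : ℕ} (h : Θ.card = n) (y : Cube) : Fin n → ℝ :=
  fun i => (y (Θ.orderEmbOfFin h i) : ℝ)

end HoloDNN

end

/-! The network imitates a polynomial: every `f` in the class is within `C s^(1/2-1/p)` in `L²` of a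
combination of at most `s` monomials of degree at most `s` in at most `s` variables. Only the
coefficients depend on `f`, and tanh networks of one fixed architecture approximate all such
combinations to any accuracy on the cube.

Polynomial part. Expand `f` in the tensorised orthonormal polynomials of the uniform measure. In one
variable, a function bounded by `M` in the ellipse of parameter `r` has `n`-th coefficient at most
`2 M r⁻ⁿ / (1 - r⁻¹)` for `n > 0`: the Fourier coefficients of `g(cos θ)` are Laurent coefficients
in an annulus, so truncated Chebyshev series converge geometrically, and the `n`-th orthonormal
polynomial annihilates all lower degrees (`norm_integral_mul_legendre_le`). Integrating out one
variable at a time gives a product bound for every admissible polyellipse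
(`abs_integral_mul_tensorLegendre_le`). Since the polyellipse may depend on the multi-index, the
radii can be chosen so that the bounds are dominated by a multinomial series whose `p`-th powers are
summable (`exists_admissible_invPow_le`, `exists_summable_envelope`).

Keep the multi-indices whose bound is large for all admissible radii. A counting argument leaves at
most `s` of them, and Stechkin's estimate yields the rate for the rest (`exists_lower_set`). The set
is closed downwards, so the Legendre partial sum is a combination of monomials with the same
exponents, its degrees are below `s`, and it involves at most `s` variables. If `b` is antitone,
these variables lie among the first `s`.

Network part. A second difference of tanh at a point where its second derivative is nonzero
reproduces squares, and polarisation turns squares into products (`exists_tanh_product`). A binary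
tree of products then evaluates `s` products of `2 ^ ⌈log₂ s⌉` affine factors with width at most `4
s²` and logarithmic depth (`approximable_sum_prod`). -/

namespace HoloDNN

section Networks

open Filter Topology

/-! ### Approximation by tanh networks, uniformly on bounded sets -/

/-- `T` is a uniform limit on bounded sets of tanh networks with hidden widths `L`. -/
def Approximable (n k : ℕ) (L : List ℕ) (T : (Fin n → ℝ) → (Fin k → ℝ)) : Prop :=
  ∀ R ε : ℝ, 0 < ε → ∃ Φ ∈ realizations Real.tanh k n L, ∀ x, ‖x‖ ≤ R → ‖Φ x - T x‖ ≤ ε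

/-- The precomposed affine map is absorbed by the first affine map of the network, so concatenating
networks costs no extra layer. -/
theorem realizations_comp_affine {σ : ℝ → ℝ} {k n m : ℕ} {L : List ℕ}
    {Ψ : (Fin n → ℝ) → (Fin k → ℝ)} (hΨ : Ψ ∈ realizations σ k n L)
    (A : (Fin m → ℝ) →ᵃ[ℝ] (Fin n → ℝ)) : (fun x => Ψ (A x)) ∈ realizations σ k m L := by
  cases L with
  | nil =>
    obtain ⟨B, rfl⟩ := hΨ
    exact ⟨B.comp A, rfl⟩
  | cons N L =>
    obtain ⟨B, Ξ, hΞ, rfl⟩ := hΨ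
    exact ⟨B.comp A, Ξ, hΞ, rfl⟩

/-- The approximation of `H` stays within distance one of a compact image. On that enlarged ball `G`
is uniformly continuous, so both errors can be made at most `ε / 2`. -/
theorem Approximable.comp {n k m N : ℕ} {L : List ℕ} {H : (Fin n → ℝ) → (Fin m → ℝ)}
    {G : (Fin m → ℝ) → (Fin k → ℝ)} (hG : Approximable m k L G) (hH : Approximable n m [N] H)
    (hGc : Continuous G) (hHc : Continuous H) :
    Approximable n k (N :: L) (fun x => G (H x)) := by
  intro R ε hε
  obtain ⟨R', hR'⟩ := ((isCompact_closedBall (0 : Fin n → ℝ) R).image hHc).isBounded.exists_norm_le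
  obtain ⟨Ψ, hΨ, hΨa⟩ := hG (R' + 1) (ε / 2) (by positivity)
  have huc := (isCompact_closedBall (0 : Fin m → ℝ) (R' + 1)).uniformContinuousOn_of_continuous
    hGc.continuousOn
  obtain ⟨δ, hδ, hδa⟩ := Metric.uniformContinuousOn_iff_le.1 huc (ε / 2) (by positivity)
  obtain ⟨Φ, hΦ, hΦa⟩ := hH R (min δ 1) (by positivity)
  obtain ⟨A, _, ⟨B, rfl⟩, rfl⟩ := hΦ
  refine ⟨_, ⟨A, _, realizations_comp_affine hΨ B, rfl⟩, fun x hx => ?_⟩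
  have h1 := hΦa x hx
  have h2 : ‖H x‖ ≤ R' := hR' _ ⟨x, by simpa using hx, rfl⟩
  set w := B (fun i => Real.tanh (A x i))
  have h3 : ‖w‖ ≤ R' + 1 := by
    have := norm_add_le (w - H x) (H x)
    rw [sub_add_cancel] at this
    linarith [min_le_right δ 1]
  have h4 := hδa w (by simpa using h3) (H x) (by simp; linarith)
    (by rw [dist_eq_norm]; exact h1.trans (min_le_left _ _))
  rw [dist_eq_norm] at h4
  have h5 := norm_add_le (Ψ w - G w) (G w - G (H x))
  rw [sub_add_sub_cancel] at h5
  linarith [hΨa w h3]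

/-- The limit is `tanh''(1) = -2 sinh 1 / cosh³ 1`. The base point 1 is used because `tanh''`
vanishes at 0. The addition formulas turn the quotient into an explicit function of `sinh t`. -/
theorem exists_tendsto_tanh_second_difference : ∃ c : ℝ, c ≠ 0 ∧
    Tendsto (fun t => (Real.tanh (1 + t) + Real.tanh (1 - t) - 2 * Real.tanh 1) / t ^ 2)
      (𝓝[≠] 0) (𝓝 c) := by
  set S := Real.sinh 1 with hS
  set C := Real.cosh 1 with hC
  have hS0 : 0 < S := Real.sinh_pos_iff.2 one_pos
  have hC0 : 0 < C := Real.cosh_pos 1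
  have hid : C ^ 2 = S ^ 2 + 1 := Real.cosh_sq 1
  refine ⟨-2 * S / C ^ 3, by
    apply div_ne_zero
    · simpa using hS0.ne'
    · positivity, ?_⟩
  have hsinh : Tendsto (fun t => Real.sinh t / t) (𝓝[≠] 0) (𝓝 1) := by
    have := (Real.hasDerivAt_sinh 0).tendsto_slope
    simpa [slope_fun_def_field] using this
  have hcont : Tendsto (fun t => -2 * S / (C * (C ^ 2 + (Real.sinh t) ^ 2))) (𝓝[≠] 0)
      (𝓝 (-2 * S / (C * (C ^ 2 + (Real.sinh 0) ^ 2)))) := by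
    apply Tendsto.mono_left _ nhdsWithin_le_nhds
    apply Continuous.tendsto
    refine Continuous.div (by fun_prop) (by fun_prop) (fun t => by positivity)
  have := hcont.mul (hsinh.pow 2)
  convert this.congr' ?_ using 2
  · simp only [Real.sinh_zero]; field_simp; simp
  filter_upwards [self_mem_nhdsWithin] with t ht
  have ht : t ≠ 0 := ht
  rw [Real.tanh_eq_sinh_div_cosh, Real.tanh_eq_sinh_div_cosh, Real.tanh_eq_sinh_div_cosh,
    Real.sinh_add, Real.cosh_add, Real.sinh_sub, Real.cosh_sub, ← hS, ← hC]
  have h1 : 0 < C * Real.cosh t + S * Real.sinh t := by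
    rw [hS, hC, ← Real.cosh_add]; exact Real.cosh_pos _
  have h2 : 0 < C * Real.cosh t - S * Real.sinh t := by
    rw [hS, hC, ← Real.cosh_sub]; exact Real.cosh_pos _
  have h3 : (C * Real.cosh t + S * Real.sinh t) * (C * Real.cosh t - S * Real.sinh t)
      = C ^ 2 + Real.sinh t ^ 2 := by
    linear_combination C ^ 2 * Real.cosh_sq t + (-(Real.sinh t)^2) * (hid.symm)
  have h4 : (S * Real.cosh t + C * Real.sinh t) / (C * Real.cosh t + S * Real.sinh t)
      + (S * Real.cosh t - C * Real.sinh t) / (C * Real.cosh t - S * Real.sinh t)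
      = 2 * S * C / (C ^ 2 + Real.sinh t ^ 2) := by
    rw [← h3, div_add_div _ _ h1.ne' h2.ne']
    congr 1
    linear_combination 2 * S * C * Real.cosh_sq t
  rw [h4]
  have h5 : C ^ 2 + Real.sinh t ^ 2 ≠ 0 := by positivity
  field_simp
  ring

/-- A second difference of `tanh` with small step approximates a product. -/
theorem exists_tanh_product (R ε : ℝ) (hε : 0 < ε) : ∃ h c : ℝ, ∀ x y : ℝ, |x| ≤ R → |y| ≤ R →
    |c * (Real.tanh (1 + h * (x + y)) + Real.tanh (1 - h * (x + y))
      - Real.tanh (1 + h * (x - y)) - Real.tanh (1 - h * (x - y))) - x * y| ≤ ε := by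
  obtain ⟨a, ha, hlim⟩ := exists_tendsto_tanh_second_difference
  set g : ℝ → ℝ := fun t => Real.tanh (1 + t) + Real.tanh (1 - t) - 2 * Real.tanh 1 with hg
  set K := 2 * |R| + 1
  have hK : 0 < K := by positivity
  set η := 2 * ε * |a| / K ^ 2 with hη
  have hη0 : 0 < η := by have := abs_pos.2 ha; positivity
  rw [Metric.tendsto_nhdsWithin_nhds] at hlim
  obtain ⟨δ, hδ, hlim⟩ := hlim η hη0
  have key : ∀ t, |t| < δ → |g t - a * t ^ 2| ≤ η * t ^ 2 := by
    intro t ht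
    by_cases h0 : t = 0
    · subst h0; simp [hg]; ring_nf
    have := (hlim (x := t) h0 (by simpa using ht)).le
    have ht2 : 0 < t ^ 2 := by positivity
    rw [Real.dist_eq] at this
    calc |g t - a * t ^ 2| = |g t / t ^ 2 - a| * t ^ 2 := by
          rw [← abs_of_pos ht2, ← abs_mul, abs_of_pos ht2]; congr 1; field_simp
      _ ≤ _ := by gcongr
  -- `K` bounds `|x + y|` and `|x - y|`, so every argument `h * u` stays within `δ / 2` of the
  -- origin.
  set h := δ / (2 * K) with hh
  have hh0 : 0 < h := by positivity
  have key2 : ∀ u, |u| ≤ K → |g (h * u) / (4 * a * h ^ 2) - u ^ 2 / 4| ≤ ε / 2 := by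
    intro u hu
    have h1 : |h * u| < δ := by
      rw [abs_mul, abs_of_pos hh0]
      calc h * |u| ≤ h * K := by gcongr
        _ = δ / 2 := by rw [hh]; field_simp
        _ < δ := by linarith
    have h2 := key _ h1
    have h3 : g (h * u) / (4 * a * h ^ 2) - u ^ 2 / 4
        = (g (h * u) - a * (h * u) ^ 2) / (4 * a * h ^ 2) := by field_simp
    have ha' := abs_pos.2 ha
    rw [h3, abs_div, abs_mul, abs_mul, abs_of_pos (by norm_num : (0 : ℝ) < 4),
      abs_of_pos (by positivity : 0 < h ^ 2), div_le_iff₀ (by positivity)]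
    have h5 : u ^ 2 ≤ K ^ 2 := by rw [← sq_abs]; gcongr
    calc _ ≤ η * (h * u) ^ 2 := h2
      _ = η * h ^ 2 * u ^ 2 := by ring
      _ ≤ η * h ^ 2 * K ^ 2 := by gcongr
      _ = _ := by rw [hη]; field_simp; ring
  refine ⟨h, 1 / (4 * a * h ^ 2), fun x y hx hy => ?_⟩
  have hR := le_abs_self R
  have h1 := key2 (x + y) ((abs_add_le x y).trans (by linarith))
  have h2 := key2 (x - y) ((abs_sub x y).trans (by linarith))
  -- Polarisation `xy = ((x + y)² - (x - y)²) / 4`; the constants `2 * tanh 1` in the two values of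
  -- `g` cancel.
  calc _ = |(g (h * (x + y)) / (4 * a * h ^ 2) - (x + y) ^ 2 / 4)
      - (g (h * (x - y)) / (4 * a * h ^ 2) - (x - y) ^ 2 / 4)| := by
        congr 1; simp only [hg]; ring
    _ ≤ _ := (abs_sub _ _).trans (by linarith)

/-- One hidden layer with four neurons per output approximates products of affine functions. -/
theorem approximable_products {n m : ℕ} (A B : Fin m → (Fin n → ℝ) →ᵃ[ℝ] ℝ) :
    Approximable n m [m * 4] (fun x i => A i x * B i x) := by
  intro R ε hε
  have hbd : ∀ f : (Fin n → ℝ) →ᵃ[ℝ] ℝ, ∃ Q, ∀ x, ‖x‖ ≤ R → |f x| ≤ Q := by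
    intro f
    obtain ⟨Q, hQ⟩ := ((isCompact_closedBall (0 : Fin n → ℝ) R).image
      f.continuous_of_finiteDimensional).isBounded.exists_norm_le
    exact ⟨Q, fun x hx => hQ _ ⟨x, by simpa using hx, rfl⟩⟩
  choose Q hQ using hbd
  set Q' := ∑ i, (|Q (A i)| + |Q (B i)|)
  have hQ' : ∀ i, |Q (A i)| + |Q (B i)| ≤ Q' := fun i =>
    Finset.single_le_sum (f := fun i => |Q (A i)| + |Q (B i)|) (fun i _ => by positivity)
      (Finset.mem_univ i)
  obtain ⟨h, c, hc⟩ := exists_tanh_product Q' ε hε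
  let one : (Fin n → ℝ) →ᵃ[ℝ] ℝ := AffineMap.const ℝ _ 1
  let w : Fin m → Fin 4 → (Fin n → ℝ) →ᵃ[ℝ] ℝ := fun i =>
    ![one + h • (A i + B i), one - h • (A i + B i), one + h • (A i - B i), one - h • (A i - B i)]
  let pr : Fin m → Fin 4 → (Fin (m * 4) → ℝ) →ₗ[ℝ] ℝ := fun i k =>
    LinearMap.proj (finProdFinEquiv (i, k))
  refine ⟨_, ⟨AffineMap.pi fun q => w (finProdFinEquiv.symm q).1 (finProdFinEquiv.symm q).2, _,
    ⟨AffineMap.pi fun i => (c • (pr i 0 + pr i 1 - pr i 2 - pr i 3)).toAffineMap, rfl⟩, rfl⟩,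
    fun x hx => ?_⟩
  rw [pi_norm_le_iff_of_nonneg hε.le]
  intro i
  have h1 := hc (A i x) (B i x)
    ((hQ (A i) x hx).trans ((le_abs_self _).trans (by linarith [hQ' i, abs_nonneg (Q (B i))])))
    ((hQ (B i) x hx).trans ((le_abs_self _).trans (by linarith [hQ' i, abs_nonneg (Q (A i))])))
  simpa [w, pr, one, -finProdFinEquiv_symm_apply, -smul_add] using h1

/-! ### Binary product trees -/

theorem prod_range_two_mul (f : ℕ → ℝ) (m : ℕ) :
    ∏ j ∈ Finset.range (2 * m), f j = ∏ j ∈ Finset.range m, (f (2 * j) * f (2 * j + 1)) := by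
  induction m with
  | zero => simp
  | succ m ih =>
    rw [show 2 * (m + 1) = 2 * m + 1 + 1 by ring, Finset.prod_range_succ, Finset.prod_range_succ,
      ih, Finset.prod_range_succ, mul_assoc]

/-- The hidden widths of a network that evaluates `s` binary product trees of height `m`. -/
def treeWidths (s : ℕ) : ℕ → List ℕ
  | 0 => [4]
  | m + 1 => (s * 2 ^ m * 4) :: treeWidths s m

theorem approximable_sum_prod (s m : ℕ) : ∀ (n : ℕ) (d : Fin s → ℝ)
    (l : Fin s → ℕ → (Fin n → ℝ) →ᵃ[ℝ] ℝ),
    Approximable n 1 (treeWidths s m)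
      (fun x _ => ∑ i, d i * ∏ j ∈ Finset.range (2 ^ m), l i j x) := by
  induction m with
  | zero =>
    intro n d l
    -- At the root the map is already affine; multiplying it by the constant 1 realises it with a
    -- hidden layer of width 4.
    have h := approximable_products (m := 1) (fun _ => ∑ i, d i • l i 0)
      (fun _ => AffineMap.const ℝ (Fin n → ℝ) 1)
    have : ∀ x, (∑ i, d i • l i 0) x = ∑ i, d i * l i 0 x := by
      intro x
      have : ∀ u : Finset (Fin s), (∑ i ∈ u, d i • l i 0) x = ∑ i ∈ u, d i * l i 0 x := by
        intro u
        induction u using Finset.induction_on with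
        | empty => simp
        | insert a u ha ih => rw [Finset.sum_insert ha, Finset.sum_insert ha, ← ih]; simp
      exact this _
    simpa [treeWidths, this] using h
  | succ m ih =>
    intro n d l
    let idx : Fin (s * 2 ^ m) → Fin s × Fin (2 ^ m) := finProdFinEquiv.symm
    -- The new factors are the coordinates produced by the first layer, each the product of two
    -- neighbouring old factors; the value 0 is never reached.
    let l' : Fin s → ℕ → (Fin (s * 2 ^ m) → ℝ) →ᵃ[ℝ] ℝ := fun i j =>
      if h : j < 2 ^ m then
        (LinearMap.proj (R := ℝ) (φ := fun _ => ℝ) (finProdFinEquiv (i, ⟨j, h⟩))).toAffineMap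
      else 0
    have hcont : ∀ {n : ℕ} (f : (Fin n → ℝ) →ᵃ[ℝ] ℝ), Continuous f := fun f =>
      f.continuous_of_finiteDimensional
    have h := (ih (s * 2 ^ m) d l').comp
      (approximable_products (fun q => l (idx q).1 (2 * (idx q).2))
        (fun q => l (idx q).1 (2 * (idx q).2 + 1)))
      (continuous_pi fun _ => continuous_finsetSum _ fun i _ => continuous_const.mul
        (continuous_finsetProd _ fun j _ => hcont _))
      (continuous_pi fun q => (hcont _).mul (hcont _))
    rw [treeWidths]
    refine (congrArg _ ?_).mpr h
    ext x _
    refine Finset.sum_congr rfl fun i _ => congrArg _ ?_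
    rw [pow_succ, mul_comm, prod_range_two_mul]
    refine Finset.prod_congr rfl fun j hj => ?_
    simp [l', Finset.mem_range.1 hj, idx, -finProdFinEquiv_symm_apply]

/-- A monomial is a product of coordinates, padded by the constant 1 up to the length that the tree
expects. -/
theorem exists_affine_factors {n : ℕ} (N : ℕ) : ∀ ν : Fin n → ℕ, ∑ i, ν i ≤ N →
    ∃ l : ℕ → (Fin n → ℝ) →ᵃ[ℝ] ℝ, ∀ x, ∏ j ∈ Finset.range N, l j x = ∏ i, x i ^ ν i := by
  induction N with
  | zero =>
    intro ν hν
    have : ∀ i, ν i = 0 := by simpa using hν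
    exact ⟨fun _ => 0, fun x => by simp [this]⟩
  | succ N ih =>
    intro ν hν
    by_cases h0 : ∀ i, ν i = 0
    · exact ⟨fun _ => AffineMap.const ℝ _ 1, fun x => by simp [h0]⟩
    push Not at h0
    obtain ⟨k, hk⟩ := h0
    have hsplit : ν = ν - Pi.single k 1 + Pi.single k 1 := by
      ext i
      by_cases hi : i = k
      · subst hi; simp; omega
      · simp [hi]
    have hsum : ∑ i, ν i = ∑ i, (ν - Pi.single k 1 : Fin n → ℕ) i + 1 := by
      conv_lhs => rw [hsplit]
      simp [Finset.sum_add_distrib, Finset.sum_pi_single']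
    obtain ⟨l, hl⟩ := ih (ν - Pi.single k 1) (by omega)
    refine ⟨fun j => if j < N then l j else
      (LinearMap.proj (R := ℝ) (φ := fun _ => ℝ) k).toAffineMap, fun x => ?_⟩
    rw [Finset.prod_range_succ]
    have h1 : ∏ j ∈ Finset.range N, (if j < N then l j else
      (LinearMap.proj (R := ℝ) (φ := fun _ => ℝ) k).toAffineMap) x
        = ∏ j ∈ Finset.range N, l j x :=
      Finset.prod_congr rfl fun j hj => by simp [Finset.mem_range.1 hj]
    rw [h1, hl]
    conv_rhs => rw [hsplit]
    simp only [Pi.add_apply, pow_add, Finset.prod_mul_distrib]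
    congr 1
    rw [Finset.prod_eq_single k] <;> simp +contextual

/-! ### Size of the tree architecture -/

theorem treeWidths_ne_nil (s m : ℕ) : treeWidths s m ≠ [] := by
  cases m <;> simp [treeWidths]

theorem treeWidths_length (s m : ℕ) : (treeWidths s m).length = m + 1 := by
  induction m with
  | zero => rfl
  | succ m ih => simp [treeWidths, ih]

theorem treeWidths_pos {s : ℕ} (hs : 1 ≤ s) (m : ℕ) : ∀ N ∈ treeWidths s m, 0 < N := by
  induction m with
  | zero => simp [treeWidths]
  | succ m ih =>
    intro N hN
    rcases List.mem_cons.1 hN with rfl | h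
    · positivity
    · exact ih N h

theorem treeWidths_foldr_le {s W : ℕ} (hW : 4 ≤ W) (m : ℕ) (h : 2 * W ≥ s * 2 ^ m * 4) :
    (treeWidths s m).foldr max 0 ≤ W := by
  induction m with
  | zero => simpa [treeWidths]
  | succ m ih =>
    simp only [treeWidths, List.foldr_cons, max_le_iff]
    rw [pow_succ] at h
    exact ⟨by linarith, ih (by nlinarith)⟩

/-- The architecture of a network that evaluates `s` products of up to `s` factors. -/
def treeArchitecture (s : ℕ) (hs : 1 ≤ s) : Architecture where
  hidden := treeWidths s (Nat.clog 2 s)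
  ne_nil := treeWidths_ne_nil _ _
  pos := treeWidths_pos hs _

theorem treeArchitecture_width_le (s : ℕ) (hs : 1 ≤ s) :
    ((treeArchitecture s hs).width : ℝ) ≤ 4 * (s : ℝ) ^ 2 := by
  have : (treeArchitecture s hs).width ≤ 4 * s ^ 2 := by
    apply treeWidths_foldr_le
    · have := Nat.one_le_pow 2 s hs; omega
    · have h2 : 2 ^ Nat.clog 2 s ≤ 2 * s := by
        rcases Nat.lt_or_ge 1 s with h | h
        · have h3 := Nat.pow_pred_clog_lt_self (b := 2) one_lt_two h
          have h4 : 0 < Nat.clog 2 s := Nat.clog_pos one_lt_two h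
          obtain ⟨k, hk⟩ := Nat.exists_eq_succ_of_ne_zero h4.ne'
          rw [hk] at h3 ⊢
          simp only [Nat.pred_eq_sub_one, Nat.succ_eq_add_one, Nat.add_sub_cancel] at h3
          rw [Nat.succ_eq_add_one, pow_succ]; omega
        · have : s = 1 := by omega
          subst this; simp
      nlinarith
  exact_mod_cast this

/-- The depth is `⌈log₂ s⌉`. For `s ≥ 2` the rounding costs at most one, which is at most `log₂ s`,
hence the factor 2; for `s = 1` both sides vanish. -/
theorem treeArchitecture_depth_le (s : ℕ) (hs : 1 ≤ s) :
    ((treeArchitecture s hs).depth : ℝ) ≤ 2 / Real.log 2 * Real.log s := by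
  have hd : (treeArchitecture s hs).depth = Nat.clog 2 s := by
    simp [Architecture.depth, treeArchitecture, treeWidths_length]
  have hl2 := Real.log_pos one_lt_two
  rw [hd]
  rcases Nat.lt_or_ge 1 s with h | h
  · have h3 := Nat.pow_pred_clog_lt_self (b := 2) one_lt_two h
    have h4 : 0 < Nat.clog 2 s := Nat.clog_pos one_lt_two h
    obtain ⟨k, hk⟩ := Nat.exists_eq_succ_of_ne_zero h4.ne'
    rw [hk] at h3 ⊢
    simp only [Nat.pred_eq_sub_one, Nat.succ_eq_add_one, Nat.add_sub_cancel] at h3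
    have h5 : k * Real.log 2 ≤ Real.log s := by
      rw [← Real.log_pow]
      exact Real.log_le_log (by positivity) (by exact_mod_cast h3.le)
    have h6 : Real.log 2 ≤ Real.log s := Real.log_le_log (by norm_num) (by exact_mod_cast h)
    rw [div_mul_eq_mul_div, le_div_iff₀ hl2]
    push_cast
    linarith
  · have : s = 1 := by omega
    subst this; simp

/-- Linear combinations of at most `s` monomials of degree at most `s` in `n` variables. -/
theorem exists_tanhDNN_monomials {ι : Type*} {n s : ℕ} (hs : 1 ≤ s) (Λ : Finset ι)
    (hΛ : Λ.card ≤ s) (e : ι → Fin n → ℕ) (hdeg : ∀ ν ∈ Λ, ∑ i, e ν i ≤ s) (d : ι → ℝ) (R : ℝ)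
    {ε : ℝ} (hε : 0 < ε) :
    ∃ Φ ∈ tanhDNN n 1 (treeArchitecture s hs), ∀ x, ‖x‖ ≤ R →
      |Φ x 0 - ∑ ν ∈ Λ, d ν * ∏ i, x i ^ e ν i| ≤ ε := by
  have hN : ∀ ν ∈ Λ, ∑ i, e ν i ≤ 2 ^ Nat.clog 2 s := fun ν hν =>
    (hdeg ν hν).trans (Nat.le_pow_clog one_lt_two s)
  choose! l hl using fun ν hν => exists_affine_factors (2 ^ Nat.clog 2 s) (e ν) (hN ν hν)
  obtain ⟨φ⟩ : Nonempty (Λ ↪ Fin s) := by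
    apply Function.Embedding.nonempty_of_card_le; simpa using hΛ
  -- Slots not used by `Λ` receive the coefficient 0, so the architecture depends on `s` alone.
  obtain ⟨Φ, hΦ, hΦa⟩ := approximable_sum_prod s (Nat.clog 2 s) n
    (Function.extend φ (fun ν => d ν) 0) (Function.extend φ (fun ν => l ν) 0) R ε hε
  refine ⟨Φ, hΦ, fun x hx => ?_⟩
  have h1 := (norm_le_pi_norm _ 0).trans (hΦa x hx)
  rw [Real.norm_eq_abs, Pi.sub_apply] at h1
  refine (le_of_eq (congrArg (fun t => |Φ x 0 - t|) ?_)).trans h1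
  rw [← Finset.sum_coe_sort]
  refine Fintype.sum_of_injective φ φ.injective _ _ ?_ ?_
  · intro i hi
    rw [Function.extend_apply' _ _ _ (by simpa using hi)]; simp
  · intro ν
    rw [φ.injective.extend_apply, φ.injective.extend_apply, hl ν ν.2]

end Networks

section MultiIndices

open scoped Nat

/-! ### Summability over multi-indices -/

/-- The general term `|ν|! / ν! * γ ^ ν` of a multinomial series. -/
noncomputable def multinomialTerm (γ : ℕ → ℝ) (ν : ℕ →₀ ℕ) : ℝ :=
  (ν.degree ! : ℝ) * ν.prod fun j n => γ j ^ n / n !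

theorem multinomialTerm_nonneg {γ : ℕ → ℝ} (hγ : ∀ j, 0 ≤ γ j) (ν : ℕ →₀ ℕ) :
    0 ≤ multinomialTerm γ ν :=
  mul_nonneg (by positivity) (Finset.prod_nonneg fun j _ => by have := hγ j; positivity)

theorem multinomialTerm_eq {γ : ℕ → ℝ} {ν : ℕ →₀ ℕ} {S : Finset ℕ} (h : ν.support ⊆ S) :
    multinomialTerm γ ν = (Nat.multinomial S ν : ℝ) * ∏ j ∈ S, γ j ^ ν j := by
  have h1 : ν.degree = ∑ j ∈ S, ν j := by
    rw [Finsupp.degree]; exact Finset.sum_subset h (by simp)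
  have h2 := Nat.multinomial_spec S ν
  have h3 : (∏ j ∈ S, ((ν j)! : ℝ)) * (Nat.multinomial S ν : ℝ) = (ν.degree ! : ℝ) := by
    rw [h1, ← h2]; push_cast; rfl
  rw [multinomialTerm, Finsupp.prod_of_support_subset _ h _ (by simp), ← h3,
    Finset.prod_div_distrib]
  have h4 : (∏ j ∈ S, ((ν j)! : ℝ)) ≠ 0 := Finset.prod_ne_zero_iff.2 fun j _ => by positivity
  field_simp

/-- By the multinomial theorem the terms of degree `n` supported in a finite `S` add up to `(∑ γ) ^
n ≤ q ^ n`, so a geometric series bounds all finite sums. -/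
theorem summable_multinomialTerm {γ : ℕ → ℝ} (hγ : ∀ j, 0 ≤ γ j) {q : ℝ} (hq : q < 1)
    (h : ∀ S : Finset ℕ, ∑ j ∈ S, γ j ≤ q) : Summable (multinomialTerm γ) := by
  have hq0 : 0 ≤ q := by simpa using h ∅
  refine summable_of_sum_le (c := ∑' n : ℕ, q ^ n) (multinomialTerm_nonneg hγ) fun u => ?_
  set S := u.biUnion Finsupp.support
  have hS : ∀ ν ∈ u, ν.support ⊆ S := fun ν hν => Finset.subset_biUnion_of_mem Finsupp.support hν
  rw [← Finset.sum_fiberwise_of_maps_to (s := u) (t := u.image Finsupp.degree)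
    (g := Finsupp.degree) (fun ν hν => Finset.mem_image_of_mem _ hν)]
  refine (Finset.sum_le_sum fun n _ => ?_).trans
    ((summable_geometric_of_lt_one hq0 hq).sum_le_tsum _ (fun n _ => by positivity))
  classical
  calc ∑ ν ∈ u with ν.degree = n, multinomialTerm γ ν
      = ∑ ν ∈ u with ν.degree = n, (Nat.multinomial S ν : ℝ) * ∏ j ∈ S, γ j ^ ν j :=
        Finset.sum_congr rfl fun ν hν => multinomialTerm_eq (hS ν (Finset.mem_filter.1 hν).1)
    _ = ∑ k ∈ {ν ∈ u | ν.degree = n}.image (fun ν : ℕ →₀ ℕ => (ν : ℕ → ℕ)),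
          (Nat.multinomial S k : ℝ) * ∏ j ∈ S, γ j ^ k j := by
        rw [Finset.sum_image fun ν _ μ _ h => Finsupp.ext (congrFun h)]
    _ ≤ ∑ k ∈ S.piAntidiag n, (Nat.multinomial S k : ℝ) * ∏ j ∈ S, γ j ^ k j := by
        refine Finset.sum_le_sum_of_subset_of_nonneg ?_ fun k _ _ =>
          mul_nonneg (by positivity) (Finset.prod_nonneg fun j _ => by have := hγ j; positivity)
        intro k hk
        obtain ⟨ν, hν, rfl⟩ := Finset.mem_image.1 hk
        obtain ⟨hνu, rfl⟩ := Finset.mem_filter.1 hν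
        rw [Finset.mem_piAntidiag]
        refine ⟨?_, fun i hi => hS ν hνu (by simpa using hi)⟩
        rw [Finsupp.degree]; exact (Finset.sum_subset (hS ν hνu) (by simp)).symm
    _ = (∑ j ∈ S, γ j) ^ n := (Finset.sum_pow_eq_sum_piAntidiag S γ n).symm
    _ ≤ q ^ n := by
        have := Finset.sum_nonneg (s := S) fun j _ => hγ j
        gcongr; exact h S

/-- Splitting off one coordinate embeds the multi-indices into pairs, on which the family is a
product of a geometric series and a summable one. This handles the finitely many coordinates whose
weight `b j` may be large. -/
theorem summable_geometric_mul_filter {q : ℝ} (hq0 : 0 ≤ q) (hq : q < 1) {H : (ℕ →₀ ℕ) → ℝ}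
    (hH0 : ∀ ν, 0 ≤ H ν) (hH : Summable H) (N : ℕ) :
    Summable fun ν : ℕ →₀ ℕ => (∏ j ∈ Finset.range N, q ^ ν j) * H (ν.filter (N ≤ ·)) := by
  induction N with
  | zero =>
    refine hH.congr fun ν => ?_
    have : ν.filter (0 ≤ ·) = ν := Finsupp.filter_eq_self_iff _ _ |>.2 fun j _ => Nat.zero_le j
    rw [this, Finset.prod_range_zero, one_mul]
  | succ N ih =>
    have h1 := (summable_geometric_of_lt_one hq0 hq).mul_of_nonneg ih
      (fun n => by positivity)
      (fun ν => mul_nonneg (Finset.prod_nonneg fun j _ => by positivity) (hH0 _))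
    have hinj : Function.Injective (fun ν : ℕ →₀ ℕ => (ν N, ν.erase N)) := by
      intro ν μ h
      simp only [Prod.mk.injEq] at h
      ext j
      by_cases hj : j = N
      · rw [hj, h.1]
      · rw [← Finsupp.erase_ne (f := ν) hj, h.2, Finsupp.erase_ne hj]
    refine (h1.comp_injective hinj).congr fun ν => ?_
    simp only [Function.comp_apply]
    rw [Finset.prod_range_succ]
    have h2 : (ν.erase N).filter (N ≤ ·) = ν.filter (N + 1 ≤ ·) := by
      ext j
      simp only [Finsupp.filter_apply]
      rcases lt_trichotomy j N with h | h | h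
      · simp [h.not_ge, (h.trans (Nat.lt_succ_self N)).not_ge]
      · simp [h]
      · simp [h.le, Nat.succ_le_of_lt h, Finsupp.erase_ne h.ne']
    have h3 : ∏ j ∈ Finset.range N, q ^ (ν.erase N) j = ∏ j ∈ Finset.range N, q ^ ν j :=
      Finset.prod_congr rfl fun j hj => by
        rw [Finsupp.erase_ne (Finset.mem_range.1 hj).ne]
    rw [h2, h3]; ring

/-! ### Admissible weights and the choice of the important multi-indices -/

/-- Admissible weights: equal to `κ` on the first `N` indices and otherwise at least two, with
excess controlled by `b`. -/
def Admissible (b : ℕ → ℝ) (κ : ℝ) (N : ℕ) (σ : ℕ → ℝ) : Prop :=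
  (∀ j < N, σ j = κ) ∧ (∀ j, N ≤ j → 2 ≤ σ j) ∧
    ∀ S : Finset ℕ, (∀ j ∈ S, N ≤ j) → ∑ j ∈ S, (σ j - 2) * b j ≤ 1 / 8

/-- The reciprocal power `σ ^ (-ν)`. -/
noncomputable def invPow (σ : ℕ → ℝ) (ν : ℕ →₀ ℕ) : ℝ := ν.prod fun j n => (σ j)⁻¹ ^ n

theorem Admissible.one_le {b : ℕ → ℝ} {κ : ℝ} {N : ℕ} {σ : ℕ → ℝ} (h : Admissible b κ N σ)
    (hκ : 1 ≤ κ) (j : ℕ) : 1 ≤ σ j := by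
  rcases Nat.lt_or_ge j N with hj | hj
  · rw [h.1 j hj]; exact hκ
  · linarith [h.2.1 j hj]

theorem invPow_pos {σ : ℕ → ℝ} (h : ∀ j, 1 ≤ σ j) (ν : ℕ →₀ ℕ) : 0 < invPow σ ν :=
  Finset.prod_pos fun j _ => by have := h j; positivity

theorem invPow_antitone {σ : ℕ → ℝ} (h : ∀ j, 1 ≤ σ j) {μ ν : ℕ →₀ ℕ} (hle : μ ≤ ν) :
    invPow σ ν ≤ invPow σ μ := by
  have hs : μ.support ⊆ ν.support := Finsupp.support_mono hle
  rw [invPow, invPow, Finsupp.prod_of_support_subset μ hs _ (by simp), Finsupp.prod]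
  refine Finset.prod_le_prod (fun j _ => ?_) (fun j _ => ?_)
  · have := h j; positivity
  · exact pow_le_pow_of_le_one (by have := h j; positivity) (inv_le_one_of_one_le₀ (h j)) (hle j)

theorem pow_self_le_exp_mul_factorial (n : ℕ) : (n : ℝ) ^ n ≤ Real.exp 1 ^ n * n ! := by
  have := Real.pow_div_factorial_le_exp (x := n) (by positivity) n
  rw [div_le_iff₀ (by positivity)] at this
  rwa [← Real.exp_nat_mul, mul_one]

/-- A multinomial coefficient is at least 1, so its `p`-th power does not exceed it. -/
theorem multinomialTerm_rpow_le {α : ℕ → ℝ} (hα : ∀ j, 0 ≤ α j) {p : ℝ} (hp1 : p < 1)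
    (ν : ℕ →₀ ℕ) : multinomialTerm α ν ^ p ≤ multinomialTerm (fun j => α j ^ p) ν := by
  rw [multinomialTerm_eq subset_rfl, multinomialTerm_eq subset_rfl,
    Real.mul_rpow (by positivity) (Finset.prod_nonneg fun j _ => by have := hα j; positivity),
    ← Real.finsetProd_rpow _ _ (fun j _ => by have := hα j; positivity)]
  have h1 : ∀ j, (α j ^ ν j) ^ p = (α j ^ p) ^ ν j := fun j => by
    rw [← Real.rpow_natCast, ← Real.rpow_natCast, ← Real.rpow_mul (hα j), ← Real.rpow_mul (hα j),
      mul_comm]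
  simp_rw [h1]
  refine mul_le_mul_of_nonneg_right ?_
    (Finset.prod_nonneg fun j _ => by have := Real.rpow_nonneg (hα j) p; positivity)
  have h2 : (1 : ℝ) ≤ Nat.multinomial ν.support ν := by
    exact_mod_cast Nat.multinomial_pos _ _
  calc _ ≤ (Nat.multinomial ν.support ν : ℝ) ^ (1 : ℝ) :=
        Real.rpow_le_rpow_of_exponent_le h2 hp1.le
    _ = _ := Real.rpow_one _

/-- The budget `1 / 8` is shared among the tail coordinates in proportion to their exponents. The
resulting `n ^ n / ∏ F j ^ F j` becomes `n! / F!` through `n ^ n ≤ e ^ n * n!` and `F j! ≤ F j ^ F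
j`. -/
theorem exists_admissible_invPow_le {b : ℕ → ℝ} (hb : ∀ j, 0 < b j) {κ : ℝ} (hκ : 0 ≤ κ) (N : ℕ)
    (ν : ℕ →₀ ℕ) : ∃ σ, Admissible b κ N σ ∧ invPow σ ν ≤ (∏ j ∈ Finset.range N, κ⁻¹ ^ ν j) *
      multinomialTerm (fun j => 8 * Real.exp 1 * b j) (ν.filter (N ≤ ·)) := by
  set F := ν.filter (N ≤ ·) with hF
  set n := F.degree with hn
  have hFj : ∀ j, N ≤ j → F j = ν j := fun j hj => Finsupp.filter_apply_pos (N ≤ ·) ν hj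
  have hn0 : (0 : ℝ) ≤ n := by positivity
  -- If the tail of `ν` vanishes, then `n = 0` and the quotient is 0, which leaves the admissible
  -- value 2.
  set σ : ℕ → ℝ := fun j => if j < N then κ else 2 + ν j / (8 * n * b j) with hσ
  have hσF : ∀ j, N ≤ j → σ j = 2 + F j / (8 * n * b j) := fun j hj => by
    simp [hσ, hj.not_gt, hFj j hj]
  refine ⟨σ, ⟨fun j hj => by simp [hσ, hj], fun j hj => ?_, fun S hS => ?_⟩, ?_⟩
  · have := hb j
    rw [hσF j hj]; linarith [show 0 ≤ (F j : ℝ) / (8 * n * b j) by positivity]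
  · have h1 : ∑ j ∈ S, F j ≤ n := by
      rw [hn, Finsupp.degree]
      calc ∑ j ∈ S, F j ≤ ∑ j ∈ S ∪ F.support, F j :=
            Finset.sum_le_sum_of_subset Finset.subset_union_left
        _ = _ := (Finset.sum_subset Finset.subset_union_right (by simp)).symm
    have h1' : (∑ j ∈ S, (F j : ℝ)) ≤ n := by exact_mod_cast h1
    calc ∑ j ∈ S, (σ j - 2) * b j = ∑ j ∈ S, (F j : ℝ) / (8 * n) :=
          Finset.sum_congr rfl fun j hj => by
            rw [hσF j (hS j hj)]; have := (hb j).ne'; field_simp; ring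
      _ = (∑ j ∈ S, (F j : ℝ)) / (8 * n) := (Finset.sum_div _ _ _).symm
      _ ≤ 1 / 8 := by
          rcases hn0.eq_or_lt with h | h
          · rw [← h]; simp
          · rw [div_le_div_iff₀ (by positivity) (by norm_num)]; linarith
  · have hsplit : invPow σ ν = (∏ j ∈ Finset.range N, κ⁻¹ ^ ν j) * invPow σ F := by
      have hsub : ν.support ⊆ Finset.range N ∪ F.support := by
        intro j hj
        rcases Nat.lt_or_ge j N with h | h
        · exact Finset.mem_union_left _ (Finset.mem_range.2 h)
        · refine Finset.mem_union_right _ ?_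
          rw [Finsupp.mem_support_iff, hFj j h]; simpa using hj
      have hge : ∀ j ∈ F.support, N ≤ j := fun j hj => by
        by_contra h
        exact Finsupp.mem_support_iff.1 hj (Finsupp.filter_apply_neg (N ≤ ·) ν h)
      have hdis : Disjoint (Finset.range N) F.support :=
        Finset.disjoint_left.2 fun j hj hj' => by
          have := hge j hj'; have := Finset.mem_range.1 hj; omega
      rw [invPow, Finsupp.prod_of_support_subset _ hsub _ (by simp), Finset.prod_union hdis]
      congr 1
      · exact Finset.prod_congr rfl fun j hj => by simp [hσ, Finset.mem_range.1 hj]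
      · exact Finset.prod_congr rfl fun j hj => by rw [hFj j (hge j hj)]
    rw [hsplit]
    refine mul_le_mul_of_nonneg_left ?_ (Finset.prod_nonneg fun j _ => by positivity)
    have hge : ∀ j ∈ F.support, N ≤ j := fun j hj => by
      by_contra h
      exact Finsupp.mem_support_iff.1 hj (Finsupp.filter_apply_neg (N ≤ ·) ν h)
    have hnpos : ∀ j ∈ F.support, 0 < n := fun j hj =>
      (Nat.pos_of_ne_zero (Finsupp.mem_support_iff.1 hj)).trans_le
        (Finset.single_le_sum (f := F) (fun _ _ => Nat.zero_le _) hj)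
    calc invPow σ F ≤ ∏ j ∈ F.support, ((n : ℝ) ^ F j * ((8 * b j) ^ F j / (F j)!)) := by
          refine Finset.prod_le_prod (fun j hj => ?_) fun j hj => ?_
          · have h1 := hσF j (hge j hj)
            have := hb j
            dsimp only; rw [h1]; positivity
          · have h1 : 0 < F j := Nat.pos_of_ne_zero (Finsupp.mem_support_iff.1 hj)
            have h2 := hnpos j hj
            have h3 := hb j
            have h4 : (σ j)⁻¹ ≤ n * (8 * b j) / F j := by
              rw [hσF j (hge j hj), inv_le_comm₀ (by positivity) (by positivity)]
              have : (n * (8 * b j) / (F j : ℝ))⁻¹ = F j / (8 * n * b j) := by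
                rw [inv_div]; congr 1; ring
              rw [this]; linarith
            have h5 : (0 : ℝ) ≤ (σ j)⁻¹ := by rw [hσF j (hge j hj)]; positivity
            have h6 : (((F j)! : ℕ) : ℝ) ≤ (F j : ℝ) ^ F j := by
              exact_mod_cast Nat.factorial_le_pow (F j)
            calc (σ j)⁻¹ ^ F j ≤ (n * (8 * b j) / F j) ^ F j := by gcongr
              _ = (n : ℝ) ^ F j * ((8 * b j) ^ F j / (F j : ℝ) ^ F j) := by
                  rw [div_pow, mul_pow, mul_div_assoc]
              _ ≤ _ := by gcongr
      _ = (n : ℝ) ^ n * ∏ j ∈ F.support, ((8 * b j) ^ F j / (F j)!) := by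
          rw [Finset.prod_mul_distrib, Finset.prod_pow_eq_pow_sum]; rfl
      _ ≤ (Real.exp 1 ^ n * n !) * ∏ j ∈ F.support, ((8 * b j) ^ F j / (F j)!) := by
          refine mul_le_mul_of_nonneg_right (pow_self_le_exp_mul_factorial n)
            (Finset.prod_nonneg fun j _ => ?_)
          have := hb j
          positivity
      _ = n ! * ∏ j ∈ F.support, (Real.exp 1 ^ F j * ((8 * b j) ^ F j / (F j)!)) := by
          rw [Finset.prod_mul_distrib, Finset.prod_pow_eq_pow_sum]
          change _ = (n ! : ℝ) * (Real.exp 1 ^ n * _)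
          ring
      _ = _ := by
          rw [multinomialTerm, Finsupp.prod]
          congr 1
          refine Finset.prod_congr rfl fun j _ => ?_
          rw [show 8 * Real.exp 1 * b j = Real.exp 1 * (8 * b j) by ring, mul_pow (Real.exp 1),
            mul_div_assoc]

/-- The envelope of the `p`-th powers of the best admissible reciprocal powers is summable. -/
theorem exists_summable_envelope {b : ℕ → ℝ} (hb : ∀ j, 0 < b j) {κ p : ℝ} (hκ : 1 < κ)
    (hp : 0 < p) (hp1 : p < 1) {N : ℕ} (hN : ∀ S : Finset ℕ, (∀ j ∈ S, N ≤ j) →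
      ∑ j ∈ S, (8 * Real.exp 1 * b j) ^ p ≤ 1 / 2) :
    ∃ D : (ℕ →₀ ℕ) → ℝ, Summable D ∧ ∀ ν, ∃ σ, Admissible b κ N σ ∧ invPow σ ν ^ p ≤ D ν := by
  set γ : ℕ → ℝ := fun j => if N ≤ j then (8 * Real.exp 1 * b j) ^ p else 0 with hγ
  have hα : ∀ j, 0 ≤ 8 * Real.exp 1 * b j := fun j => by have := hb j; positivity
  have hγ0 : ∀ j, 0 ≤ γ j := fun j => by
    simp only [hγ]; split_ifs
    · exact Real.rpow_nonneg (hα j) p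
    · exact le_rfl
  have hsum : Summable (multinomialTerm γ) := by
    refine summable_multinomialTerm hγ0 (q := 1 / 2) (by norm_num) fun S => ?_
    simp only [hγ]
    rw [← Finset.sum_filter]
    exact hN _ fun j hj => (Finset.mem_filter.1 hj).2
  have hq1 : (κ⁻¹) ^ p < 1 := Real.rpow_lt_one (by positivity) (inv_lt_one_of_one_lt₀ hκ) hp
  have hq0 : 0 ≤ (κ⁻¹) ^ p := Real.rpow_nonneg (by positivity) p
  refine ⟨_, summable_geometric_mul_filter hq0 hq1 (multinomialTerm_nonneg hγ0) hsum N,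
    fun ν => ?_⟩
  obtain ⟨σ, hσ, hle⟩ := exists_admissible_invPow_le hb (by linarith : 0 ≤ κ) N ν
  refine ⟨σ, hσ, ?_⟩
  have hpos := (invPow_pos (hσ.one_le hκ.le) ν).le
  refine (Real.rpow_le_rpow hpos hle hp.le).trans ?_
  have hκ0 : 0 ≤ κ⁻¹ := by positivity
  rw [Real.mul_rpow (Finset.prod_nonneg fun j _ => by positivity) (multinomialTerm_nonneg hα _),
    ← Real.finsetProd_rpow _ _ (fun j _ => by positivity)]
  have h1 : ∀ j, (κ⁻¹ ^ ν j) ^ p = (κ⁻¹ ^ p) ^ ν j := fun j => by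
    rw [← Real.rpow_natCast, ← Real.rpow_natCast, ← Real.rpow_mul hκ0, ← Real.rpow_mul hκ0,
      mul_comm]
  simp_rw [h1]
  refine mul_le_mul_of_nonneg_left ?_ (Finset.prod_nonneg fun j _ => by positivity)
  refine (multinomialTerm_rpow_le hα hp1 _).trans (le_of_eq ?_)
  unfold multinomialTerm
  congr 1
  refine Finset.prod_congr rfl fun j hj => ?_
  have : N ≤ j := by
    by_contra h
    exact Finsupp.mem_support_iff.1 hj (Finsupp.filter_apply_neg (N ≤ ·) ν h)
  simp [hγ, this]

/-- A lower set of `s` multi-indices outside of which every sequence dominated by all admissible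
reciprocal powers has a small `ℓ²` norm. -/
theorem exists_lower_set {b : ℕ → ℝ} (hb : ∀ j, 0 < b j) {κ p C₀ : ℝ} (hκ : 1 < κ)
    (hκ2 : κ ≤ 2) (hC₀ : 0 < C₀) (hp : 0 < p) (hp1 : p < 1) {N : ℕ}
    (hN : ∀ S : Finset ℕ, (∀ j ∈ S, N ≤ j) → ∑ j ∈ S, (8 * Real.exp 1 * b j) ^ p ≤ 1 / 2) :
    ∃ C : ℝ, 0 ≤ C ∧ ∀ s : ℕ, 1 ≤ s → ∃ Λ : Finset (ℕ →₀ ℕ), Λ.card ≤ s ∧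
      (∀ ν ∈ Λ, ∀ μ ≤ ν, μ ∈ Λ) ∧
      (Antitone b → ∀ i j, i ≤ j → Finsupp.single j 1 ∈ Λ → Finsupp.single i 1 ∈ Λ) ∧
      ∀ c : (ℕ →₀ ℕ) → ℝ, (∀ ν σ, Admissible b κ N σ → |c ν| ≤ C₀ * invPow σ ν) →
        ∀ u : Finset (ℕ →₀ ℕ), Disjoint u Λ →
          ∑ ν ∈ u, c ν ^ 2 ≤ (C * (s : ℝ) ^ (1 / 2 - 1 / p)) ^ 2 := by
  obtain ⟨D, hD, hDσ⟩ := exists_summable_envelope hb hκ hp hp1 hN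
  have hD0 : ∀ ν, 0 ≤ D ν := fun ν => by
    obtain ⟨σ, hσ, h⟩ := hDσ ν
    exact (Real.rpow_nonneg (invPow_pos (hσ.one_le hκ.le) ν).le p).trans h
  set S₀ := C₀ ^ p * ∑' ν, D ν + 1 with hS₀
  have hC₀p : 0 < C₀ ^ p := Real.rpow_pos_of_pos hC₀ p
  have hS₀pos : 0 < S₀ := by have : 0 ≤ ∑' ν, D ν := tsum_nonneg hD0; positivity
  have hsumD : ∀ u : Finset (ℕ →₀ ℕ), ∑ ν ∈ u, C₀ ^ p * D ν ≤ S₀ := fun u => by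
    rw [← Finset.mul_sum]
    have := mul_le_mul_of_nonneg_left (hD.sum_le_tsum u fun ν _ => hD0 ν) hC₀p.le
    linarith
  refine ⟨S₀ ^ (1 / p), by positivity, fun s hs => ?_⟩
  have hs0 : (0 : ℝ) < s := by exact_mod_cast hs
  set ε := (S₀ / s) ^ (1 / p) with hε
  have hε0 : 0 < ε := by positivity
  have hεp : ε ^ p = S₀ / s := by
    rw [hε, ← Real.rpow_mul (by positivity), one_div_mul_cancel hp.ne', Real.rpow_one]
  -- The threshold is imposed on the bounds rather than on the coefficients, so the set serves all
  -- functions at once and inherits monotonicity in `ν`.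
  set Λ' : Set (ℕ →₀ ℕ) := {ν | ∀ σ, Admissible b κ N σ → ε ≤ C₀ * invPow σ ν} with hΛ'
  have hmem : ∀ ν ∈ Λ', S₀ / s ≤ C₀ ^ p * D ν := fun ν hν => by
    obtain ⟨σ, hσ, h⟩ := hDσ ν
    have hpos := (invPow_pos (hσ.one_le hκ.le) ν).le
    rw [← hεp]
    calc ε ^ p ≤ (C₀ * invPow σ ν) ^ p := Real.rpow_le_rpow hε0.le (hν σ hσ) hp.le
      _ = C₀ ^ p * invPow σ ν ^ p := Real.mul_rpow hC₀.le hpos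
      _ ≤ _ := by gcongr
  -- Each member contributes at least `ε ^ p = S₀ / s` to a sum bounded by `S₀`.
  have hcard : ∀ u : Finset (ℕ →₀ ℕ), (u : Set _) ⊆ Λ' → u.card ≤ s := fun u hu => by
    have h1 : (u.card : ℝ) * (S₀ / s) ≤ S₀ := by
      refine le_trans ?_ (hsumD u)
      rw [← nsmul_eq_mul]
      exact Finset.card_nsmul_le_sum _ _ _ fun ν hν => hmem ν (hu hν)
    rw [mul_div_assoc', div_le_iff₀ hs0, mul_comm] at h1
    exact_mod_cast le_of_mul_le_mul_left h1 hS₀pos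
  have hfin : Λ'.Finite := by
    by_contra h
    obtain ⟨u, hu, hc⟩ := Set.Infinite.exists_subset_card_eq h (s + 1)
    have := hcard u hu
    omega
  refine ⟨hfin.toFinset, hcard _ (by simp), ?_, ?_, ?_⟩
  · intro ν hν μ hμ
    rw [Set.Finite.mem_toFinset] at hν ⊢
    intro σ hσ
    exact (hν σ hσ).trans (mul_le_mul_of_nonneg_left
      (invPow_antitone (hσ.one_le hκ.le) hμ) hC₀.le)
  · intro hanti i j hij hj
    rw [Set.Finite.mem_toFinset] at hj ⊢
    intro σ hσ
    rcases hij.eq_or_lt with rfl | hij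
    · exact hj σ hσ
    set t := if N ≤ i then σ i else 2 with ht
    have ht2 : 2 ≤ t := by
      simp only [ht]; split_ifs with h
      · exact hσ.2.1 i h
      · exact le_rfl
    have hti : σ i ≤ t := by
      simp only [ht]; split_ifs with h
      · exact le_rfl
      · rw [hσ.1 i (not_le.1 h)]; exact hκ2
    -- The weight of `i` is moved to `j`. This costs no more because `b j ≤ b i`, and `κ ≤ 2` covers
    -- the case `i < N ≤ j`.
    set σ' : ℕ → ℝ := fun k => if k < N then κ else if k = j then t else 2 with hσ'
    have hadm : Admissible b κ N σ' := by
      refine ⟨fun k hk => by simp [hσ', hk], fun k hk => ?_, fun S hS => ?_⟩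
      · simp only [hσ', hk.not_gt, if_false]; split_ifs
        · exact ht2
        · exact le_rfl
      · have h1 : ∀ k ∈ S, (σ' k - 2) * b k = if k = j then (t - 2) * b j else 0 := fun k hk => by
          simp only [hσ', (hS k hk).not_gt, if_false]; split_ifs with h
          · rw [h]
          · simp
        rw [Finset.sum_congr rfl h1, Finset.sum_ite_eq']
        have h2 : (t - 2) * b j ≤ 1 / 8 := by
          by_cases h : N ≤ i
          · have h3 := hσ.2.2 {i} (by simpa using h)
            simp only [Finset.sum_singleton] at h3
            have h4 : t = σ i := by simp [ht, h]
            have h5 := hσ.2.1 i h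
            rw [h4]
            exact (mul_le_mul_of_nonneg_left (hanti hij.le) (by linarith)).trans h3
          · simp [ht, h]
        split_ifs
        · exact h2
        · norm_num
    have h1 := hj σ' hadm
    have h2 : invPow σ' (Finsupp.single j 1) ≤ invPow σ (Finsupp.single i 1) := by
      have hσi := hσ.one_le hκ.le i
      simp only [invPow, pow_zero, Finsupp.prod_single_index, pow_one]
      refine inv_anti₀ (by linarith) ?_
      by_cases h : j < N
      · rw [hσ.1 i (hij.trans h)]; simp [hσ', h]
      · simpa [hσ', h] using hti
    exact h1.trans (mul_le_mul_of_nonneg_left h2 hC₀.le)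
  · intro c hc u hu
    -- Stechkin's estimate: outside the set `|c ν| ≤ ε`, hence `c² ≤ ε ^ (2 - p) * |c| ^ p`.
    have hterm : ∀ ν ∈ u, c ν ^ 2 ≤ ε ^ (2 - p) * (C₀ ^ p * D ν) := fun ν hν => by
      have h1 : ν ∉ Λ' := fun h => Finset.disjoint_left.1 hu hν (by simpa using h)
      simp only [hΛ', Set.mem_ofPred_eq, not_forall, not_le] at h1
      obtain ⟨σ, hσ, h1⟩ := h1
      have h2 : |c ν| ≤ ε := (hc ν σ hσ).trans h1.le
      obtain ⟨τ, hτ, h3⟩ := hDσ ν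
      have hpos := (invPow_pos (hτ.one_le hκ.le) ν).le
      have h4 : |c ν| ^ p ≤ C₀ ^ p * D ν := by
        calc |c ν| ^ p ≤ (C₀ * invPow τ ν) ^ p :=
              Real.rpow_le_rpow (abs_nonneg _) (hc ν τ hτ) hp.le
          _ = C₀ ^ p * invPow τ ν ^ p := Real.mul_rpow hC₀.le hpos
          _ ≤ _ := by gcongr
      calc c ν ^ 2 = |c ν| ^ (2 - p) * |c ν| ^ p := by
            rw [← Real.rpow_add_of_nonneg (abs_nonneg _) (by linarith) hp.le, sub_add_cancel,
              ← sq_abs]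
            exact (Real.rpow_two _).symm
        _ ≤ _ := mul_le_mul (Real.rpow_le_rpow (abs_nonneg _) h2 (by linarith)) h4
            (by positivity) (by positivity)
    calc ∑ ν ∈ u, c ν ^ 2 ≤ ∑ ν ∈ u, ε ^ (2 - p) * (C₀ ^ p * D ν) := Finset.sum_le_sum hterm
      _ = ε ^ (2 - p) * ∑ ν ∈ u, C₀ ^ p * D ν := (Finset.mul_sum _ _ _).symm
      _ ≤ ε ^ (2 - p) * S₀ := by gcongr; exact hsumD u
      _ = _ := by
        rw [hε, ← Real.rpow_mul (by positivity), Real.div_rpow hS₀pos.le hs0.le, mul_pow,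
          ← Real.rpow_natCast (S₀ ^ (1 / p)), ← Real.rpow_mul hS₀pos.le,
          ← Real.rpow_natCast ((s : ℝ) ^ _), ← Real.rpow_mul hs0.le, div_mul_eq_mul_div]
        nth_rewrite 2 [← Real.rpow_one S₀]
        rw [← Real.rpow_add hS₀pos, div_eq_mul_inv, ← Real.rpow_neg hs0.le]
        congr 2
        · field_simp; push_cast; ring
        · field_simp; push_cast; ring

end MultiIndices

section Ellipses

open Polynomial

/-! ### Bernstein ellipses -/

/-- The interior of the Bernstein ellipse, described through its foci. -/
def openEllipse (r : ℝ) : Set ℂ := {w | ‖w - 1‖ + ‖w + 1‖ < r + r⁻¹}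

theorem mem_openEllipse {r : ℝ} {w : ℂ} : w ∈ openEllipse r ↔ ‖w - 1‖ + ‖w + 1‖ < r + r⁻¹ :=
  Iff.rfl

theorem isOpen_openEllipse (r : ℝ) : IsOpen (openEllipse r) :=
  isOpen_lt (by fun_prop) continuous_const

/-- The distances to the foci are `|z ∓ 1|² / (2 |z|)`, and the parallelogram law adds them. This
links the parametrised ellipse with its focal description. -/
theorem joukowsky_norm {z : ℂ} (hz : z ≠ 0) :
    ‖(z + z⁻¹) / 2 - 1‖ + ‖(z + z⁻¹) / 2 + 1‖ = ‖z‖ + ‖z‖⁻¹ := by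
  have h1 : (z + z⁻¹) / 2 - 1 = (z - 1) ^ 2 / (2 * z) := by field_simp; ring
  have h2 : (z + z⁻¹) / 2 + 1 = (z + 1) ^ 2 / (2 * z) := by field_simp; ring
  have hz' : ‖z‖ ≠ 0 := norm_ne_zero_iff.2 hz
  have h3 : ‖z + 1‖ ^ 2 + ‖z - 1‖ ^ 2 = 2 * (‖z‖ ^ 2 + 1) := by
    have := parallelogram_law_with_norm ℝ z 1
    simp only [norm_one] at this
    nlinarith
  rw [h1, h2, norm_div, norm_div, norm_pow, norm_pow, norm_mul, ← add_div, add_comm, h3]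
  simp only [Complex.norm_ofNat]
  field_simp

/-- The two preimages `w ± √(w² - 1)` are mutually inverse, so one of them has modulus at least 1.
-/
theorem exists_joukowsky (w : ℂ) : ∃ z : ℂ, 1 ≤ ‖z‖ ∧ w = (z + z⁻¹) / 2 := by
  obtain ⟨s, hs⟩ := IsAlgClosed.exists_pow_nat_eq (w ^ 2 - 1) (n := 2) two_pos
  have hmul : (w + s) * (w - s) = 1 := by linear_combination -hs
  have h0 : w + s ≠ 0 := left_ne_zero_of_mul_eq_one hmul
  have hinv : (w + s)⁻¹ = w - s := inv_eq_of_mul_eq_one_right hmul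
  by_cases h : 1 ≤ ‖w + s‖
  · exact ⟨w + s, h, by rw [hinv]; ring⟩
  · refine ⟨(w + s)⁻¹, ?_, by rw [inv_inv, hinv]; ring⟩
    rw [norm_inv]
    exact (one_le_inv₀ (norm_pos_iff.2 h0)).2 (not_le.1 h).le

theorem add_inv_lt_add_inv {x y : ℝ} (hx : 1 ≤ x) (hxy : x < y) : x + x⁻¹ < y + y⁻¹ := by
  have hx0 : 0 < x := by linarith
  have hy0 : 0 < y := by linarith
  have h : y + y⁻¹ - (x + x⁻¹) = (y - x) * (x * y - 1) / (x * y) := by field_simp; ring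
  have h2 : 0 < (y - x) * (x * y - 1) / (x * y) := by
    have : 0 < x * y - 1 := by nlinarith
    have : 0 < y - x := by linarith
    positivity
  linarith

theorem openEllipse_subset_bernsteinEllipse {r : ℝ} (hr : 1 ≤ r) :
    openEllipse r ⊆ bernsteinEllipse r := by
  intro w hw
  obtain ⟨z, hz, rfl⟩ := exists_joukowsky w
  have hz0 : z ≠ 0 := norm_pos_iff.1 (by linarith)
  have hw' : ‖z‖ + ‖z‖⁻¹ < r + r⁻¹ := by rw [← joukowsky_norm hz0]; exact hw
  refine ⟨z, hz, ?_, rfl⟩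
  by_contra! h
  linarith [add_inv_lt_add_inv hr h]

theorem joukowsky_mem_openEllipse {r : ℝ} {z : ℂ} (hr : 1 < r) (h1 : r⁻¹ < ‖z‖) (h2 : ‖z‖ < r) :
    (z + z⁻¹) / 2 ∈ openEllipse r := by
  have hz : 0 < ‖z‖ := lt_trans (by positivity) h1
  rw [mem_openEllipse, joukowsky_norm (norm_pos_iff.1 hz)]
  rcases le_total 1 ‖z‖ with h | h
  · exact add_inv_lt_add_inv h h2
  · have := add_inv_lt_add_inv (x := ‖z‖⁻¹) (y := r) ((one_le_inv₀ hz).2 h)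
      (inv_lt_of_inv_lt₀ (by linarith) h1)
    rwa [inv_inv, add_comm ‖z‖⁻¹] at this

theorem ofReal_mem_openEllipse {r : ℝ} (hr : 1 < r) {t : ℝ} (ht : t ∈ Icc (-1 : ℝ) 1) :
    (t : ℂ) ∈ openEllipse r := by
  have h1 : ‖(t : ℂ) - 1‖ = 1 - t := by
    rw [← Complex.ofReal_one, ← Complex.ofReal_sub, Complex.norm_real, Real.norm_eq_abs,
      abs_of_nonpos (by linarith [ht.2])]; ring
  have h2 : ‖(t : ℂ) + 1‖ = t + 1 := by
    rw [← Complex.ofReal_one, ← Complex.ofReal_add, Complex.norm_real, Real.norm_eq_abs,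
      abs_of_nonneg (by linarith [ht.1])]
  rw [mem_openEllipse, h1, h2]
  have := add_inv_lt_add_inv le_rfl hr
  norm_num at this
  linarith

theorem ofReal_mem_bernsteinEllipse_one {t : ℝ} (ht : t ∈ Icc (-1 : ℝ) 1) :
    (t : ℂ) ∈ bernsteinEllipse 1 := by
  obtain ⟨z, hz, h⟩ := exists_joukowsky t
  refine ⟨z, hz, ?_, h⟩
  by_contra! h1
  have h2 := ofReal_mem_openEllipse h1 ht
  have hz0 : z ≠ 0 := norm_pos_iff.1 (by linarith)
  have h3 := joukowsky_norm hz0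
  rw [← h] at h3
  rw [mem_openEllipse] at h2
  linarith

/-! ### Polynomial approximation of functions holomorphic in an ellipse -/

section Approximation

variable {g : ℂ → ℂ} {M r : ℝ}

/-- Cauchy's estimate for a Laurent coefficient: the Joukowsky map sends the annulus `r⁻¹ < |z| < r`
into the ellipse, so the unit circle may be moved to radius `R`. -/
theorem norm_circleIntegral_joukowsky_le (hr : 1 < r)
    (hg : ∀ w ∈ openEllipse r, DifferentiableAt ℂ g w) (hM : ∀ w ∈ openEllipse r, ‖g w‖ ≤ M)
    (k : ℤ) {R : ℝ} (hR1 : r⁻¹ < R) (hR2 : R < r) :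
    ‖(2 * Real.pi * Complex.I)⁻¹ • ∮ z in C(0, 1), z⁻¹ • (z ^ (-k) * g ((z + z⁻¹) / 2))‖
      ≤ M * R ^ (-k) := by
  have hr0 : 0 < r := by linarith
  have hrinv : r⁻¹ < 1 := inv_lt_one_of_one_lt₀ hr
  have hR0 : 0 < R := lt_trans (by positivity) hR1
  have hd : ∀ z : ℂ, r⁻¹ < ‖z‖ → ‖z‖ < r →
      DifferentiableAt ℂ (fun z => z ^ (-k) * g ((z + z⁻¹) / 2)) z := by
    intro z h1 h2
    have hz : z ≠ 0 := norm_pos_iff.1 (lt_trans (by positivity) h1)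
    refine (differentiableAt_zpow.2 (Or.inl hz)).mul ?_
    refine DifferentiableAt.comp z (hg _ (joukowsky_mem_openEllipse hr h1 h2)) ?_
    exact (differentiableAt_id.add (differentiableAt_inv hz)).div_const 2
  have key : ∀ {a c : ℝ}, r⁻¹ < a → a ≤ c → c < r →
      ∮ z in C(0, c), z⁻¹ • (z ^ (-k) * g ((z + z⁻¹) / 2))
        = ∮ z in C(0, a), z⁻¹ • (z ^ (-k) * g ((z + z⁻¹) / 2)) := by
    intro a c ha hac hc
    have := Complex.circleIntegral_sub_center_inv_smul_eq_of_differentiable_on_annulus_off_countable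
      (c := 0) (r := a) (R := c) (lt_trans (by positivity) ha) hac
      (f := fun z => z ^ (-k) * g ((z + z⁻¹) / 2)) (s := ∅) countable_empty
      (fun z hz => (hd z (by simp at hz; linarith) (by simp at hz; linarith)
        ).continuousAt.continuousWithinAt)
      (fun z hz => hd z (by simp at hz; linarith) (by simp at hz; linarith))
    simpa using this
  have hcircle : ∮ z in C(0, 1), z⁻¹ • (z ^ (-k) * g ((z + z⁻¹) / 2))
      = ∮ z in C(0, R), z⁻¹ • (z ^ (-k) * g ((z + z⁻¹) / 2)) := by
    rcases le_total R 1 with h | h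
    · exact key hR1 h hr
    · exact (key hrinv h hR2).symm
  rw [hcircle]
  have := circleIntegral.norm_two_pi_i_inv_smul_integral_le_of_norm_le_const (c := 0) hR0.le
    (f := fun z => z⁻¹ • (z ^ (-k) * g ((z + z⁻¹) / 2))) (C := R⁻¹ * (R ^ (-k) * M)) (by
      intro z hz
      have hz' : ‖z‖ = R := by simpa using hz
      rw [norm_smul, norm_inv, norm_mul, norm_zpow, hz']
      gcongr
      exact hM _ (joukowsky_mem_openEllipse hr (by rwa [hz']) (by rwa [hz'])))
  refine this.trans (le_of_eq ?_)
  field_simp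

/-- The Fourier coefficients of `g (cos θ)` are Laurent coefficients of `g ((z + z⁻¹) / 2)`. Radius
`R` bounds those with `k ≥ 0`, radius `R⁻¹` the others. -/
theorem exists_hasSum_cos (hr : 1 < r)
    (hg : ∀ w ∈ openEllipse r, DifferentiableAt ℂ g w) (hM : ∀ w ∈ openEllipse r, ‖g w‖ ≤ M)
    {R : ℝ} (hR1 : 1 < R) (hR2 : R < r) :
    ∃ a : ℤ → ℂ, (∀ k : ℤ, ‖a k‖ ≤ M * R⁻¹ ^ k.natAbs) ∧
      ∀ θ : ℝ, HasSum (fun k : ℤ => a k * Complex.cos (k * θ)) (g (Real.cos θ)) := by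
  have : Fact (0 < 2 * Real.pi) := ⟨by positivity⟩
  have hmem : ∀ θ : ℝ, ((Real.cos θ : ℝ) : ℂ) ∈ openEllipse r := fun θ =>
    ofReal_mem_openEllipse hr ⟨Real.neg_one_le_cos θ, Real.cos_le_one θ⟩
  let φ : ℝ → ℂ := fun θ => g (Real.cos θ)
  have hφc : Continuous φ := continuous_iff_continuousAt.2 fun θ =>
    ContinuousAt.comp (g := g) (f := fun θ : ℝ => ((Real.cos θ : ℝ) : ℂ))
      (hg _ (hmem θ)).continuousAt (by fun_prop)
  have hφp : Function.Periodic φ (2 * Real.pi) := fun θ => by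
    simp only [φ, Real.cos_add_two_pi]
  let f : C(AddCircle (2 * Real.pi), ℂ) := ⟨hφp.lift, hφc.quotient_lift _⟩
  have hf : ∀ θ : ℝ, f θ = φ θ := fun θ => hφp.lift_coe θ
  have hcoef : ∀ k, fourierCoeff f k = (2 * Real.pi * Complex.I)⁻¹ •
      ∮ z in C(0, 1), z⁻¹ • (z ^ (-k) * g ((z + z⁻¹) / 2)) := by
    intro k
    rw [fourierCoeff_eq_intervalIntegral _ _ 0, circleIntegral, zero_add]
    have : ∀ θ : ℝ, deriv (circleMap 0 1) θ • ((circleMap 0 1 θ)⁻¹ • ((circleMap 0 1 θ) ^ (-k) *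
        g ((circleMap 0 1 θ + (circleMap 0 1 θ)⁻¹) / 2)))
        = Complex.I * ((fourier (-k)) (θ : AddCircle (2 * Real.pi)) • f θ) := by
      intro θ
      have h1 : circleMap 0 1 θ = Complex.exp (θ * Complex.I) := by simp [circleMap]
      have h2 : (circleMap 0 1 θ + (circleMap 0 1 θ)⁻¹) / 2 = ((Real.cos θ : ℝ) : ℂ) := by
        rw [h1, ← Complex.exp_neg, Complex.ofReal_cos, Complex.cos]
        ring_nf
      have h3 : (fourier (-k)) (θ : AddCircle (2 * Real.pi)) = (circleMap 0 1 θ) ^ (-k) := by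
        rw [fourier_coe_apply, h1, ← Complex.exp_int_mul]
        congr 1
        have : (Real.pi : ℂ) ≠ 0 := by exact_mod_cast Real.pi_ne_zero
        push_cast
        field_simp
      have h4 : circleMap 0 1 θ ≠ 0 := by rw [h1]; exact Complex.exp_ne_zero _
      rw [h2, h3, hf, deriv_circleMap]
      simp only [smul_eq_mul, φ]
      field_simp
    simp_rw [this]
    rw [intervalIntegral.integral_const_mul]
    simp only [smul_eq_mul, Complex.real_smul]
    have : (Real.pi : ℂ) ≠ 0 := by exact_mod_cast Real.pi_ne_zero
    push_cast
    field_simp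
  have hbound : ∀ k : ℤ, ‖fourierCoeff f k‖ ≤ M * R⁻¹ ^ k.natAbs := by
    intro k
    rw [hcoef]
    have hrR : r⁻¹ < R⁻¹ := inv_strictAnti₀ (by linarith) hR2
    have hR' : R⁻¹ < 1 := inv_lt_one_of_one_lt₀ hR1
    rcases Int.natAbs_eq k with h | h
    · have := norm_circleIntegral_joukowsky_le hr hg hM k (R := R) (by linarith) hR2
      refine this.trans (le_of_eq ?_)
      conv_lhs => rw [h]
      rw [zpow_neg, zpow_natCast, inv_pow]
    · have := norm_circleIntegral_joukowsky_le hr hg hM k (R := R⁻¹) hrR (by linarith)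
      refine this.trans (le_of_eq ?_)
      conv_lhs => rw [h]
      rw [neg_neg, zpow_natCast]
  have hsum : Summable (fourierCoeff f) := by
    refine Summable.of_norm_bounded (g := fun k : ℤ => M * R⁻¹ ^ k.natAbs) ?_ hbound
    refine Summable.mul_left _ ?_
    have hgeo := summable_geometric_of_lt_one (r := R⁻¹) (by positivity)
      (inv_lt_one_of_one_lt₀ hR1)
    exact Summable.of_nat_of_neg (by simpa using hgeo) (by simpa using hgeo)
  refine ⟨fourierCoeff f, hbound, fun θ => ?_⟩
  have h1 := has_pointwise_sum_fourier_series_of_summable hsum (θ : AddCircle (2 * Real.pi))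
  have h2 := has_pointwise_sum_fourier_series_of_summable hsum
    ((-θ : ℝ) : AddCircle (2 * Real.pi))
  -- Evenness in `θ`: averaging the series at `θ` and `-θ` replaces exponentials by cosines.
  have h3 := (h1.add h2).div_const 2
  have hpi : (Real.pi : ℂ) ≠ 0 := by exact_mod_cast Real.pi_ne_zero
  rw [hf, hf] at h3
  simp only [φ, Real.cos_neg, add_self_div_two] at h3
  refine h3.congr_fun fun k => ?_ 
  rw [fourier_coe_apply, fourier_coe_apply, Complex.cos]
  simp only [smul_eq_mul]
  have e1 : 2 * Real.pi * Complex.I * k * θ / ((2 * Real.pi : ℝ) : ℂ) = k * θ * Complex.I := by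
    push_cast; field_simp
  have e2 : 2 * Real.pi * Complex.I * k * ((-θ : ℝ) : ℂ) / ((2 * Real.pi : ℝ) : ℂ)
      = -(k * θ) * Complex.I := by
    push_cast; field_simp
  rw [e1, e2]; ring

theorem exists_polynomial_approx (hr : 1 < r)
    (hg : ∀ w ∈ openEllipse r, DifferentiableAt ℂ g w) (hM : ∀ w ∈ openEllipse r, ‖g w‖ ≤ M)
    {R : ℝ} (hR1 : 1 < R) (hR2 : R < r) {n : ℕ} (hn : 0 < n) :
    ∃ q : ℂ[X], q.natDegree < n ∧ ∀ x ∈ Icc (-1 : ℝ) 1,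
      ‖q.eval (x : ℂ) - g x‖ ≤ 2 * M * R⁻¹ ^ n / (1 - R⁻¹) := by
  obtain ⟨a, ha, hsum⟩ := exists_hasSum_cos hr hg hM hR1 hR2
  let T : ℕ → ℂ[X] := fun k => Polynomial.Chebyshev.T ℂ (k : ℤ)
  -- A truncated Chebyshev series; `a 0` is subtracted because folding `k` with `-k` counts it
  -- twice.
  refine ⟨∑ k ∈ Finset.range n, Polynomial.C (a k + a (-k)) * T k - Polynomial.C (a 0), ?_, ?_⟩
  · refine lt_of_le_of_lt (natDegree_sub_le_of_le (m := n - 1) (n := 0)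
      (natDegree_sum_le_of_forall_le _ _ fun k hk => ?_) (by simp)) (by omega)
    refine (natDegree_C_mul_le _ _).trans ?_
    simp only [T, Polynomial.Chebyshev.natDegree_T, Int.natAbs_natCast]
    have := Finset.mem_range.1 hk; omega
  · intro x hx
    have hcos : Real.cos (Real.arccos x) = x := Real.cos_arccos hx.1 hx.2
    have h1 := (hsum (Real.arccos x)).nat_add_neg
    rw [hcos] at h1
    have h2 := norm_sub_le_of_geometric_bound_of_hasSum (r := R⁻¹) (C := 2 * M)
      (inv_lt_one_of_one_lt₀ hR1) (fun k => ?_) h1 n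
    · refine (le_of_eq ?_).trans h2
      congr 1
      simp only [eval_sub, eval_finsetSum, eval_mul, eval_C, Int.cast_zero, zero_mul,
        Complex.cos_zero, mul_one]
      have : ∀ k : ℕ, (a k + a (-k)) * (T k).eval (x : ℂ)
          = a k * Complex.cos ((k : ℤ) * (Real.arccos x : ℂ))
            + a (-k) * Complex.cos ((-k : ℤ) * (Real.arccos x : ℂ)) := by
        intro k
        conv_lhs => rw [← hcos]
        rw [Complex.ofReal_cos, Polynomial.Chebyshev.T_complex_cos]
        push_cast
        rw [neg_mul, Complex.cos_neg]; ring
      simp_rw [this]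
      ring
    · have hc : ∀ m : ℤ, ‖Complex.cos (m * (Real.arccos x : ℂ))‖ ≤ 1 := fun m => by
        have : (m : ℂ) * (Real.arccos x : ℂ) = ((m * Real.arccos x : ℝ) : ℂ) := by push_cast; rfl
        rw [this, ← Complex.ofReal_cos, Complex.norm_real]
        exact Real.abs_cos_le_one _
      have hk : ∀ m : ℤ, ‖a m * Complex.cos (m * (Real.arccos x : ℂ))‖ ≤ M * R⁻¹ ^ m.natAbs :=
        fun m => by
          rw [norm_mul]
          exact (mul_le_of_le_one_right (norm_nonneg _) (hc m)).trans (ha m)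
      have e1 := hk k
      have e2 := hk (-k)
      simp only [Int.natAbs_neg, Int.natAbs_natCast] at e1 e2
      refine (norm_add_le _ _).trans ?_
      linarith

end Approximation

end Ellipses

section OrthonormalPolynomials

open Polynomial

/-! ### Orthonormal polynomials for the uniform measure -/

theorem integrable_unif {E : Type*} [NormedAddCommGroup E] {f : Icc (-1 : ℝ) 1 → E}
    (hf : Continuous f) : Integrable f unif :=
  hf.integrable_of_hasCompactSupport (HasCompactSupport.of_compactSpace f)

theorem continuous_eval_coe (p : ℝ[X]) : Continuous fun x : Icc (-1 : ℝ) 1 => p.eval (x : ℝ) :=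
  p.continuous.comp continuous_subtype_val

theorem integrable_eval_mul (p q : ℝ[X]) :
    Integrable (fun x : Icc (-1 : ℝ) 1 => p.eval (x : ℝ) * q.eval (x : ℝ)) unif :=
  integrable_unif ((continuous_eval_coe p).mul (continuous_eval_coe q))

instance : NullSingletonClass unif := by
  constructor
  intro x
  rw [unif, Measure.smul_apply, comap_subtype_coe_apply measurableSet_Icc]
  simp

theorem eq_zero_of_integral_sq_eq_zero {p : ℝ[X]}
    (h : ∫ x, p.eval (x : ℝ) * p.eval (x : ℝ) ∂unif = 0) : p = 0 := by
  by_contra hp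
  rw [integral_eq_zero_iff_of_nonneg (fun x => mul_self_nonneg _)
    (integrable_eval_mul p p)] at h
  have hfin : {x : Icc (-1 : ℝ) 1 | p.eval (x : ℝ) = 0}.Finite := by
    refine Set.Finite.of_finite_image ((p.roots.toFinset.finite_toSet).subset ?_)
      Subtype.val_injective.injOn
    rintro _ ⟨x, hx, rfl⟩
    simpa [hp] using hx
  have h0 := hfin.measure_zero unif
  have h1 : unif univ = 0 := by
    refine measure_mono_null (fun x _ => ?_) (measure_union_null h h0)
    by_cases hx : p.eval (x : ℝ) = 0
    · exact Or.inr hx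
    · exact Or.inl (by simpa using hx)
  rw [measure_univ] at h1
  exact one_ne_zero h1

/-- The inner product of `L²` on polynomials. -/
noncomputable abbrev polynomialInnerCore : InnerProductSpace.Core ℝ ℝ[X] where
  inner p q := ∫ x, p.eval (x : ℝ) * q.eval (x : ℝ) ∂unif
  conj_inner_symm p q := by simp [mul_comm]
  re_inner_nonneg p := integral_nonneg fun x => mul_self_nonneg _
  add_left p q t := by
    simp only [eval_add, add_mul]
    exact integral_add (integrable_eval_mul _ _)
      (integrable_eval_mul _ _)
  smul_left p q t := by
    simp only [eval_smul, smul_eq_mul, mul_assoc, integral_const_mul]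
    simp
  definite p h := eq_zero_of_integral_sq_eq_zero h

theorem exists_orthonormal_polynomials : ∃ L : ℕ → ℝ[X], L 0 = 1 ∧
    (∀ m n, ∫ x, (L m).eval (x : ℝ) * (L n).eval (x : ℝ) ∂unif = if m = n then 1 else 0) ∧
    (∀ n, L n ∈ Submodule.span ℝ ((fun k : ℕ => (X ^ k : ℝ[X])) '' Iic n)) ∧
    (∀ n, (X ^ n : ℝ[X]) ∈ Submodule.span ℝ (L '' Iic n)) := by
  let _ : NormedAddCommGroup ℝ[X] :=
    @InnerProductSpace.Core.toNormedAddCommGroup ℝ ℝ[X] _ _ _ polynomialInnerCore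
  let _ : InnerProductSpace ℝ ℝ[X] := InnerProductSpace.ofCore polynomialInnerCore.toCore
  have hli : LinearIndependent ℝ (fun k : ℕ => (X ^ k : ℝ[X])) := by
    have := (Polynomial.basisMonomials ℝ).linearIndependent
    simpa [Polynomial.coe_basisMonomials, ← Polynomial.monomial_one_right_eq_X_pow] using this
  let v : ℕ → ℝ[X] := fun k => X ^ k
  have hspan : ∀ n, Submodule.span ℝ (InnerProductSpace.gramSchmidtNormed ℝ v '' Iic n)
      = Submodule.span ℝ (v '' Iic n) := fun n => by
    rw [InnerProductSpace.span_gramSchmidtNormed, InnerProductSpace.span_gramSchmidt_Iic]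
  refine ⟨InnerProductSpace.gramSchmidtNormed ℝ v, ?_, fun m n => ?_, fun n => ?_, fun n => ?_⟩
  · have h1 : ‖(1 : ℝ[X])‖ = 1 := by
      rw [← sq_eq_sq₀ (norm_nonneg _) zero_le_one, ← real_inner_self_eq_norm_sq]
      change ∫ x, (1 : ℝ[X]).eval (x : ℝ) * (1 : ℝ[X]).eval (x : ℝ) ∂unif = _
      simp
    have h2 : InnerProductSpace.gramSchmidt ℝ v 0 = 1 := by
      rw [InnerProductSpace.gramSchmidt_def]
      simp [v]
    rw [InnerProductSpace.gramSchmidtNormed, h2, h1]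
    simp
  · exact orthonormal_iff_ite.1 (InnerProductSpace.gramSchmidtNormed_orthonormal hli) m n
  · rw [← hspan]; exact Submodule.subset_span ⟨n, mem_Iic.2 le_rfl, rfl⟩
  · rw [hspan]; exact Submodule.subset_span ⟨n, mem_Iic.2 le_rfl, rfl⟩

/-- The orthonormal polynomials of the uniform measure on `[-1,1]`. -/
noncomputable def legendre : ℕ → ℝ[X] := exists_orthonormal_polynomials.choose

theorem legendre_zero : legendre 0 = 1 := exists_orthonormal_polynomials.choose_spec.1

theorem integral_legendre_mul (m n : ℕ) :
    ∫ x, (legendre m).eval (x : ℝ) * (legendre n).eval (x : ℝ) ∂unif = if m = n then 1 else 0 :=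
  exists_orthonormal_polynomials.choose_spec.2.1 m n

theorem legendre_mem_span (n : ℕ) :
    legendre n ∈ Submodule.span ℝ ((fun k : ℕ => (X ^ k : ℝ[X])) '' Iic n) :=
  exists_orthonormal_polynomials.choose_spec.2.2.1 n

theorem X_pow_mem_span_legendre (n : ℕ) :
    (X ^ n : ℝ[X]) ∈ Submodule.span ℝ (legendre '' Iic n) :=
  exists_orthonormal_polynomials.choose_spec.2.2.2 n

theorem integral_pow_mul_legendre {k n : ℕ} (h : k < n) :
    ∫ x, (x : ℝ) ^ k * (legendre n).eval (x : ℝ) ∂unif = 0 := by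
  have key : ∀ p ∈ Submodule.span ℝ (legendre '' Iic k),
      ∫ x, p.eval (x : ℝ) * (legendre n).eval (x : ℝ) ∂unif = 0 := by
    intro p hp
    induction hp using Submodule.span_induction with
    | mem p hp =>
      obtain ⟨m, hm, rfl⟩ := hp
      rw [integral_legendre_mul, if_neg (by have := mem_Iic.1 hm; omega)]
    | zero => simp
    | add p q _ _ hp hq =>
      simp only [eval_add, add_mul]
      rw [integral_add (integrable_eval_mul _ _)
        (integrable_eval_mul _ _), hp, hq, add_zero]
    | smul a p _ hp =>
      simp only [eval_smul, smul_eq_mul, mul_assoc, integral_const_mul, hp, mul_zero]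
  simpa using key _ (X_pow_mem_span_legendre k)

/-- From `|t| ≤ (t² + 1) / 2`, the normalisation, and total mass 1. -/
theorem integral_abs_legendre_le (n : ℕ) : ∫ x, |(legendre n).eval (x : ℝ)| ∂unif ≤ 1 := by
  have h1 : ∀ x : Icc (-1 : ℝ) 1, |(legendre n).eval (x : ℝ)|
      ≤ ((legendre n).eval (x : ℝ) * (legendre n).eval (x : ℝ) + 1) / 2 := fun x => by
    nlinarith [sq_nonneg (|(legendre n).eval (x : ℝ)| - 1),
      abs_mul_abs_self ((legendre n).eval (x : ℝ))]
  have hc := continuous_eval_coe (legendre n)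
  refine (integral_mono (integrable_unif hc.abs)
    (((integrable_eval_mul _ _).add (integrable_const 1)).div_const 2) h1).trans ?_
  simp only [Pi.add_apply]
  rw [integral_div, integral_add (integrable_eval_mul _ _) (integrable_const _),
    integral_legendre_mul]
  simp

/-- The orthonormal polynomials as functions. -/
noncomputable def legendreFun (n : ℕ) (x : ℝ) : ℝ := (legendre n).eval x

/-- Decay of the Legendre coefficients of a function holomorphic in an ellipse. -/
theorem norm_integral_mul_legendre_le {g : ℂ → ℂ} {M r : ℝ} (hr : 1 < r)
    (hg : ∀ w ∈ openEllipse r, DifferentiableAt ℂ g w) (hM : ∀ w ∈ openEllipse r, ‖g w‖ ≤ M)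
    {n : ℕ} (hn : 0 < n) :
    ‖∫ x, g (x : ℝ) * (legendreFun n x : ℂ) ∂unif‖ ≤ 2 * M * r⁻¹ ^ n / (1 - r⁻¹) := by
  have hLc : Continuous fun x : Icc (-1 : ℝ) 1 => (legendreFun n x : ℂ) :=
    Complex.continuous_ofReal.comp (continuous_eval_coe _)
  have hgc : Continuous fun x : Icc (-1 : ℝ) 1 => g (x : ℝ) :=
    continuous_iff_continuousAt.2 fun x =>
      ContinuousAt.comp (g := g) (f := fun x : Icc (-1 : ℝ) 1 => ((x : ℝ) : ℂ))
        (hg _ (ofReal_mem_openEllipse hr x.2)).continuousAt (by fun_prop)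
  have hinteg : ∀ {h : Icc (-1 : ℝ) 1 → ℂ}, Continuous h →
      Integrable (fun x => h x * (legendreFun n x : ℂ)) unif := fun hh =>
    integrable_unif (hh.mul hLc)
  -- Polynomials of degree below `n` are orthogonal to the `n`-th one, so only the approximation
  -- error counts. The bound holds for `R < r`; letting `R` tend to `r` removes the loss.
  have key : ∀ R : ℝ, 1 < R → R < r →
      ‖∫ x, g (x : ℝ) * (legendreFun n x : ℂ) ∂unif‖
        ≤ 2 * M * R⁻¹ ^ n / (1 - R⁻¹) := by
    intro R hR1 hR2
    obtain ⟨q, hq, hqa⟩ := exists_polynomial_approx hr hg hM hR1 hR2 hn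
    have hqc : Continuous fun x : Icc (-1 : ℝ) 1 => q.eval ((x : ℝ) : ℂ) :=
      q.continuous.comp (by fun_prop)
    have h0 : ∫ x : Icc (-1 : ℝ) 1, q.eval ((x : ℝ) : ℂ) * (legendreFun n x : ℂ) ∂unif
        = 0 := by
      simp_rw [Polynomial.eval_eq_sum_range' hq, Finset.sum_mul, mul_assoc]
      rw [integral_finsetSum _ fun k _ => (hinteg (h := fun x : Icc (-1 : ℝ) 1 =>
        ((x : ℝ) : ℂ) ^ k) (by fun_prop)).const_mul _]
      refine Finset.sum_eq_zero fun k hk => ?_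
      rw [integral_const_mul]
      have : ∀ x : Icc (-1 : ℝ) 1, ((x : ℝ) : ℂ) ^ k * (legendreFun n x : ℂ)
          = (((x : ℝ) ^ k * legendreFun n x : ℝ) : ℂ) := fun x => by push_cast; rfl
      simp_rw [this]
      have h1 : ∫ x : Icc (-1 : ℝ) 1, (x : ℝ) ^ k * legendreFun n x ∂unif = 0 :=
        integral_pow_mul_legendre (Finset.mem_range.1 hk)
      rw [integral_complex_ofReal, h1]
      simp
    set B := 2 * M * R⁻¹ ^ n / (1 - R⁻¹)
    have hB : 0 ≤ B := (norm_nonneg _).trans (hqa 0 (by norm_num))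
    calc _ = ‖∫ x : Icc (-1 : ℝ) 1,
          (g (x : ℝ) - q.eval ((x : ℝ) : ℂ)) * (legendreFun n x : ℂ) ∂unif‖ := by
          simp_rw [sub_mul]
          rw [integral_sub (hinteg hgc) (hinteg hqc), h0,
            sub_zero]
      _ ≤ ∫ x : Icc (-1 : ℝ) 1, B * |legendreFun n x| ∂unif := by
          refine norm_integral_le_of_norm_le
            ((integrable_unif (continuous_eval_coe _).abs).const_mul B) (ae_of_all _ fun x => ?_)
          rw [norm_mul, norm_sub_rev, Complex.norm_real, Real.norm_eq_abs]
          exact mul_le_mul_of_nonneg_right (hqa x x.2) (abs_nonneg _)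
      _ ≤ B := by
          rw [integral_const_mul]
          exact mul_le_of_le_one_right hB (integral_abs_legendre_le n)
  have hr0 : r ≠ 0 := by linarith
  have hr1 : 1 - r⁻¹ ≠ 0 := by
    have := inv_lt_one_of_one_lt₀ hr; linarith
  have hcont : ContinuousAt (fun R : ℝ => 2 * M * R⁻¹ ^ n / (1 - R⁻¹)) r :=
    ContinuousAt.div (continuousAt_const.mul ((continuousAt_inv₀ hr0).pow n))
      (continuousAt_const.sub (continuousAt_inv₀ hr0)) hr1
  refine ge_of_tendsto (hcont.tendsto.mono_left (nhdsWithin_le_nhds (s := Iio r))) ?_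
  filter_upwards [Ioo_mem_nhdsLT hr] with R hR using key R hR.1 hR.2

end OrthonormalPolynomials

section CoefficientBounds

/-! ### Coefficient bounds in infinitely many variables -/

instance : IsProbabilityMeasure rho := by unfold rho; infer_instance

/-- Replacing one coordinate by an independent copy preserves the product measure. -/
theorem measurePreserving_update (j : ℕ) :
    MeasurePreserving (fun q : Cube × Icc (-1 : ℝ) 1 => Function.update q.1 j q.2)
      (rho.prod unif) rho := by
  have hm : Measurable (fun q : Cube × Icc (-1 : ℝ) 1 => Function.update q.1 j q.2) :=
    measurable_update'
  refine ⟨hm, ?_⟩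
  refine Measure.eq_infinitePi _ fun s t ht => ?_
  rw [Measure.map_apply hm (MeasurableSet.pi s.countable_toSet fun i _ => ht i)]
  by_cases hj : j ∈ s
  · have : (fun q : Cube × Icc (-1 : ℝ) 1 => Function.update q.1 j q.2) ⁻¹' (s : Set ℕ).pi t
        = ((s.erase j : Finset ℕ) : Set ℕ).pi t ×ˢ t j := by
      ext ⟨y, u⟩
      simp only [mem_preimage, Set.mem_pi, Finset.mem_coe, mem_prod, Finset.mem_erase]
      constructor
      · intro h
        refine ⟨fun i hi => ?_, by simpa using h j hj⟩
        have := h i hi.2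
        rwa [Function.update_of_ne hi.1] at this
      · rintro ⟨h1, h2⟩ i hi
        by_cases hij : i = j
        · subst hij; simpa using h2
        · rw [Function.update_of_ne hij]; exact h1 i ⟨hij, hi⟩
    rw [this, Measure.prod_prod, rho, Measure.infinitePi_pi _ (fun i _ => ht i),
      Finset.prod_erase_mul _ _ hj]
  · have : (fun q : Cube × Icc (-1 : ℝ) 1 => Function.update q.1 j q.2) ⁻¹' (s : Set ℕ).pi t
        = (s : Set ℕ).pi t ×ˢ univ := by
      ext ⟨y, u⟩
      simp only [mem_preimage, Set.mem_pi, Finset.mem_coe, mem_prod, mem_univ, and_true]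
      refine forall₂_congr fun i hi => ?_
      rw [Function.update_of_ne (by rintro rfl; exact hj hi)]
    rw [this, Measure.prod_prod, rho, Measure.infinitePi_pi _ (fun i _ => ht i), measure_univ,
      mul_one]

/-- A parametric integral of bounded holomorphic functions is differentiable. -/
theorem differentiableAt_integral_of_bounded {Ψ : ℂ → Icc (-1 : ℝ) 1 → ℂ} {x₀ : ℂ} {δ M : ℝ}
    (hδ : 0 < δ)
    (hd : ∀ h ∈ Metric.ball x₀ (2 * δ), ∀ t, DifferentiableAt ℂ (fun h => Ψ h t) h)
    (hb : ∀ h ∈ Metric.ball x₀ (2 * δ), ∀ t, ‖Ψ h t‖ ≤ M)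
    (hc : ∀ h ∈ Metric.ball x₀ (2 * δ), Continuous (Ψ h)) :
    DifferentiableAt ℂ (fun h => ∫ t, Ψ h t ∂unif) x₀ := by
  have hx₀ : x₀ ∈ Metric.ball x₀ (2 * δ) := Metric.mem_ball_self (by positivity)
  -- The derivative is a pointwise limit of difference quotients, each continuous in `t`.
  have hmeas : AEStronglyMeasurable (fun t => deriv (fun h => Ψ h t) x₀) unif := by
    let u : ℕ → ℂ := fun n => x₀ + ((δ * (1 / ((n : ℝ) + 1)) : ℝ) : ℂ)
    have hpos : ∀ n : ℕ, 0 < δ * (1 / ((n : ℝ) + 1)) := fun n => by positivity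
    have hu : ∀ n, u n ∈ Metric.ball x₀ (2 * δ) := fun n => by
      have h1 : (1 : ℝ) / (n + 1) ≤ 1 := by
        rw [div_le_one (by positivity)]; linarith [(Nat.cast_nonneg n : (0 : ℝ) ≤ n)]
      rw [Metric.mem_ball, dist_eq_norm]
      simp only [u, add_sub_cancel_left, Complex.norm_real, Real.norm_eq_abs,
        abs_of_pos (hpos n)]
      nlinarith
    have hlim : Filter.Tendsto u Filter.atTop (nhdsWithin x₀ {x₀}ᶜ) := by
      refine tendsto_nhdsWithin_iff.2 ⟨?_, Filter.Eventually.of_forall fun n => ?_⟩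
      · have h1 := (tendsto_one_div_add_atTop_nhds_zero_nat (𝕜 := ℝ)).const_mul δ
        have h2 := ((Complex.continuous_ofReal.tendsto _).comp h1).const_add x₀
        simpa [u, Function.comp_def] using h2
      · simp only [u, mem_compl_iff, mem_singleton_iff, add_eq_left, Complex.ofReal_eq_zero]
        exact (hpos n).ne'
    refine aestronglyMeasurable_of_tendsto_ae Filter.atTop
      (f := fun n t => slope (fun h => Ψ h t) x₀ (u n)) (fun n => ?_) (ae_of_all _ fun t => ?_)
    · simp only [slope_def_field]
      exact (((hc _ (hu n)).sub (hc _ hx₀)).div_const _).aestronglyMeasurable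
    · exact (hd x₀ hx₀ t).hasDerivAt.tendsto_slope.comp hlim
  have hsub : Metric.ball x₀ δ ⊆ Metric.ball x₀ (2 * δ) := Metric.ball_subset_ball (by linarith)
  refine (hasDerivAt_integral_of_dominated_loc_of_deriv_le (bound := fun _ => M / δ)
    (F' := fun x t => deriv (fun h => Ψ h t) x) (s := Metric.ball x₀ δ)
    (Metric.ball_mem_nhds x₀ hδ) ?_ (integrable_unif (hc _ hx₀)) hmeas
    (ae_of_all _ fun t x hx => ?_) (integrable_const _)
    (ae_of_all _ fun t x hx => (hd x (hsub hx) t).hasDerivAt)).2.differentiableAt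
  · filter_upwards [Metric.ball_mem_nhds x₀ hδ] with x hx
    exact (hc x (hsub hx)).aestronglyMeasurable
  · have hcl : Metric.closedBall x δ ⊆ Metric.ball x₀ (2 * δ) := fun z hz => by
      rw [Metric.mem_ball] at hx ⊢
      rw [Metric.mem_closedBall] at hz
      linarith [dist_triangle z x x₀]
    -- Cauchy's estimate on a circle of radius `δ` supplies the dominating constant `M / δ`.
    refine Complex.norm_deriv_le_of_forall_mem_sphere_norm_le hδ
      (DifferentiableOn.diffContOnCl_ball (U := Metric.ball x₀ (2 * δ))
        (fun z hz => (hd z hz t).differentiableWithinAt) hcl) fun z hz => ?_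
    exact hb z (hcl (Metric.sphere_subset_closedBall hz)) t

/-! ### Integrating out one variable at a time -/

/-- Points whose coordinates lie in open ellipses for indices in `S`, and in `[-1,1]` otherwise. -/
def partialDomain (S : Finset ℕ) (r : ℕ → ℝ) : Set (ℕ → ℂ) :=
  {w | (∀ j ∈ S, w j ∈ openEllipse (r j)) ∧ ∀ j ∉ S, ∃ t : Icc (-1 : ℝ) 1, w j = (t : ℝ)}

/-- Separate holomorphy in the variables of `S`, together with a bound. -/
structure BoundedHolomorphic (S : Finset ℕ) (r : ℕ → ℝ) (M : ℝ) (F : (ℕ → ℂ) → ℂ) : Prop where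
  diff : ∀ w ∈ partialDomain S r, ∀ j ∈ S,
    DifferentiableAt ℂ (fun z => F (Function.update w j z)) (w j)
  bound : ∀ w ∈ partialDomain S r, ‖F w‖ ≤ M

/-- The inclusion of the real cube. -/
def complexify (y : Cube) : ℕ → ℂ := fun j => ((y j : ℝ) : ℂ)

theorem complexify_update (y : Cube) (j : ℕ) (t : Icc (-1 : ℝ) 1) :
    complexify (Function.update y j t) = Function.update (complexify y) j ((t : ℝ) : ℂ) := by
  ext i
  by_cases h : i = j
  · subst h; simp [complexify]
  · simp [complexify, h]

theorem complexify_mem_partialDomain {S : Finset ℕ} {r : ℕ → ℝ} (hr : ∀ j ∈ S, 1 < r j)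
    (y : Cube) : complexify y ∈ partialDomain S r :=
  ⟨fun j hj => ofReal_mem_openEllipse (hr j hj) (y j).2, fun j _ => ⟨y j, rfl⟩⟩

theorem update_mem_partialDomain_insert {S : Finset ℕ} {r : ℕ → ℝ} {w : ℕ → ℂ}
    (hw : w ∈ partialDomain S r) {j : ℕ} {z : ℂ} (hz : z ∈ openEllipse (r j)) :
    Function.update w j z ∈ partialDomain (insert j S) r := by
  refine ⟨fun i hi => ?_, fun i hi => ?_⟩
  · by_cases h : i = j
    · subst h; simpa using hz
    · rw [Function.update_of_ne h]
      exact hw.1 i (Finset.mem_of_mem_insert_of_ne hi h)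
  · rw [Finset.mem_insert, not_or] at hi
    rw [Function.update_of_ne hi.1]
    exact hw.2 i hi.2

theorem update_mem_partialDomain {S : Finset ℕ} {r : ℕ → ℝ} {w : ℕ → ℂ}
    (hw : w ∈ partialDomain S r) {i : ℕ} (hi : i ∈ S) {z : ℂ} (hz : z ∈ openEllipse (r i)) :
    Function.update w i z ∈ partialDomain S r := by
  have := update_mem_partialDomain_insert hw hz
  rwa [Finset.insert_eq_of_mem hi] at this

theorem continuous_legendreFun (n : ℕ) : Continuous (legendreFun n) := (legendre n).continuous

/-- The bound for the `n`-th coefficient of a function bounded by one in an ellipse. -/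
noncomputable def coeffBound (r : ℝ) (n : ℕ) : ℝ := 2 * r⁻¹ ^ n / (1 - r⁻¹)

/-- Integrating out one variable against an orthonormal polynomial. -/
theorem BoundedHolomorphic.integrate {S : Finset ℕ} {r : ℕ → ℝ} {M : ℝ} {F : (ℕ → ℂ) → ℂ} {j : ℕ}
    (hj : j ∉ S) (hr : 1 < r j) (hF : BoundedHolomorphic (insert j S) r M F) {n : ℕ}
    (hn : 0 < n) :
    BoundedHolomorphic S r (M * coeffBound (r j) n) (fun w =>
      ∫ t : Icc (-1 : ℝ) 1,
        F (Function.update w j ((t : ℝ) : ℂ)) * (legendreFun n t : ℂ) ∂unif) := by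
  have hdj : ∀ w ∈ partialDomain S r, ∀ z ∈ openEllipse (r j),
      DifferentiableAt ℂ (fun z => F (Function.update w j z)) z := by
    intro w hw z hz
    have := hF.diff _ (update_mem_partialDomain_insert hw hz) j (Finset.mem_insert_self _ _)
    simpa using this
  refine ⟨fun w hw i hi => ?_, fun w hw => ?_⟩
  · have hij : i ≠ j := fun h => hj (h ▸ hi)
    obtain ⟨ε, hε, hball⟩ := Metric.isOpen_iff.1 (isOpen_openEllipse (r i)) (w i) (hw.1 i hi)
    obtain ⟨B, hB⟩ := (isCompact_univ.image (show Continuous fun t : Icc (-1 : ℝ) 1 =>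
      legendreFun n t from (continuous_legendreFun n).comp
        continuous_subtype_val)).isBounded.exists_norm_le
    have hB' : ∀ t : Icc (-1 : ℝ) 1, ‖(legendreFun n t : ℂ)‖ ≤ B := fun t => by
      rw [Complex.norm_real]; exact hB _ ⟨t, mem_univ _, rfl⟩
    have hmem : ∀ h ∈ Metric.ball (w i) (2 * (ε / 2)), h ∈ openEllipse (r i) := fun h hh =>
      hball (by rwa [mul_div_cancel₀ _ two_ne_zero] at hh)
    refine differentiableAt_integral_of_bounded (δ := ε / 2) (M := M * B)
      (Ψ := fun h t => F (Function.update (Function.update w i h) j ((t : ℝ) : ℂ)) *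
        (legendreFun n t : ℂ)) (by positivity) (fun h hh t => ?_) (fun h hh t => ?_)
      (fun h hh => ?_)
    · refine DifferentiableAt.mul_const ?_ _
      have hp := update_mem_partialDomain_insert (j := j)
        (update_mem_partialDomain hw hi (hmem h hh)) (ofReal_mem_openEllipse hr t.2)
      have := hF.diff _ hp i (Finset.mem_insert_of_mem hi)
      rw [Function.update_of_ne hij, Function.update_self] at this
      refine this.congr_of_eventuallyEq (Filter.Eventually.of_forall fun z => ?_)
      refine congrArg F (funext fun k => ?_)
      by_cases hk : k = i
      · subst hk; simp [hij]
      · by_cases hk' : k = j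
        · subst hk'; simp [hk]
        · simp [hk, hk']
    · have hp := update_mem_partialDomain_insert (j := j)
        (update_mem_partialDomain hw hi (hmem h hh)) (ofReal_mem_openEllipse hr t.2)
      rw [norm_mul]
      exact mul_le_mul (hF.bound _ hp) (hB' t) (norm_nonneg _)
        ((norm_nonneg _).trans (hF.bound _ hp))
    · refine Continuous.mul ?_ (Complex.continuous_ofReal.comp
        ((continuous_legendreFun n).comp continuous_subtype_val))
      refine continuous_iff_continuousAt.2 fun t => ?_
      exact ContinuousAt.comp
        (g := fun z => F (Function.update (Function.update w i h) j z))
        (f := fun t : Icc (-1 : ℝ) 1 => ((t : ℝ) : ℂ))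
        (hdj _ (update_mem_partialDomain hw hi (hmem h hh)) _
          (ofReal_mem_openEllipse hr t.2)).continuousAt (by fun_prop)
  · have := norm_integral_mul_legendre_le hr (hdj w hw)
      (fun z hz => hF.bound _ (update_mem_partialDomain_insert hw hz)) hn
    refine this.trans (le_of_eq ?_)
    rw [coeffBound]; ring

theorem continuous_prod_legendreFun (S : Finset ℕ) (ν : ℕ → ℕ) :
    Continuous fun y : Cube => ∏ i ∈ S, legendreFun (ν i) (y i) :=
  continuous_finsetProd _ fun i _ => (continuous_legendreFun _).comp
    (continuous_subtype_val.comp (continuous_apply i))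

theorem exists_bound_prod_legendreFun (S : Finset ℕ) (ν : ℕ → ℕ) :
    ∃ B, ∀ y : Cube, ‖∏ i ∈ S, legendreFun (ν i) (y i)‖ ≤ B := by
  obtain ⟨B, hB⟩ := (isCompact_univ.image
    (continuous_prod_legendreFun S ν)).isBounded.exists_norm_le
  exact ⟨B, fun y => hB _ ⟨y, mem_univ _, rfl⟩⟩

/-- The bound for the coefficients of a separately holomorphic function. -/
theorem norm_integral_mul_prod_legendreFun_le {r : ℕ → ℝ} {ν : ℕ → ℕ} (S : Finset ℕ) :
    (∀ j ∈ S, 1 < r j) → (∀ j ∈ S, 0 < ν j) → ∀ (F : (ℕ → ℂ) → ℂ) (M : ℝ),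
    BoundedHolomorphic S r M F → AEStronglyMeasurable (fun y => F (complexify y)) rho →
    ‖∫ y : Cube, F (complexify y) * ((∏ j ∈ S, legendreFun (ν j) (y j) : ℝ) : ℂ) ∂rho‖
      ≤ M * ∏ j ∈ S, coeffBound (r j) (ν j) := by
  induction S using Finset.induction_on with
  | empty =>
    intro _ _ F M hF hm
    have := norm_integral_le_of_norm_le_const (μ := rho) (f := fun y => F (complexify y)) (C := M)
      (ae_of_all _ fun y => hF.bound _ (complexify_mem_partialDomain (by simp) y))
    simpa using this
  | insert j S hj ih =>
    intro hr hν F M hF hm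
    have hrj := hr j (Finset.mem_insert_self _ _)
    have hrS : ∀ i ∈ S, 1 < r i := fun i hi => hr i (Finset.mem_insert_of_mem hi)
    have hmp := measurePreserving_update j
    set f : Cube → ℂ := fun y => F (complexify y) with hf
    have hfb : ∀ y, ‖f y‖ ≤ M := fun y => hF.bound _ (complexify_mem_partialDomain hr y)
    have hm1 : AEStronglyMeasurable (fun q : Cube × Icc (-1 : ℝ) 1 =>
        f (Function.update q.1 j q.2) * (legendreFun (ν j) q.2 : ℂ)) (rho.prod unif) := by
      refine (hm.comp_measurePreserving hmp).mul (Continuous.aestronglyMeasurable ?_)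
      exact Complex.continuous_ofReal.comp ((continuous_legendreFun _).comp
        (continuous_subtype_val.comp continuous_snd))
    have hm' := hm1.integral_prod_right'
    have hcu : ∀ y : Cube, (∫ t : Icc (-1 : ℝ) 1,
        F (Function.update (complexify y) j ((t : ℝ) : ℂ)) * (legendreFun (ν j) t : ℂ) ∂unif)
        = ∫ t, f (Function.update y j t) * (legendreFun (ν j) t : ℂ) ∂unif := fun y => by
      simp only [hf, complexify_update]
    -- The function with variable `j` integrated out is again bounded and holomorphic in the
    -- variables of `S`, so induction applies. Resampling coordinate `j` independently lets Fubini
    -- identify the two integrals.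
    have hG := hF.integrate hj hrj (hν j (Finset.mem_insert_self _ _))
    have key := ih hrS (fun i hi => hν i (Finset.mem_insert_of_mem hi)) _ _ hG (by
      simp only [hcu]; exact hm')
    rw [Finset.prod_insert hj, ← mul_assoc]
    refine (le_of_eq (congrArg _ ?_)).trans key
    simp only [hcu]
    obtain ⟨B, hB⟩ := exists_bound_prod_legendreFun (insert j S) ν
    have hmi : AEStronglyMeasurable (fun y : Cube =>
        f y * ((∏ i ∈ insert j S, legendreFun (ν i) (y i) : ℝ) : ℂ)) rho :=
      hm.mul (Complex.continuous_ofReal.comp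
        (continuous_prod_legendreFun (insert j S) ν)).aestronglyMeasurable
    have hinteg : Integrable (fun y : Cube =>
        f y * ((∏ i ∈ insert j S, legendreFun (ν i) (y i) : ℝ) : ℂ)) rho := by
      refine Integrable.of_bound hmi (M * B) (ae_of_all _ fun y => ?_)
      rw [norm_mul, Complex.norm_real]
      exact mul_le_mul (hfb y) (hB y) (norm_nonneg _) ((norm_nonneg _).trans (hfb y))
    have hinteg' := hmp.integrable_comp_of_integrable hinteg
    calc ∫ y, f y * ((∏ i ∈ insert j S, legendreFun (ν i) (y i) : ℝ) : ℂ) ∂rho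
        = ∫ q, ((fun y : Cube => f y * ((∏ i ∈ insert j S, legendreFun (ν i) (y i) : ℝ) : ℂ)) ∘
            fun q : Cube × Icc (-1 : ℝ) 1 => Function.update q.1 j q.2) q ∂(rho.prod unif) := by
          have h1 := integral_map (μ := rho.prod unif) hmp.measurable.aemeasurable
            (f := fun y : Cube => f y * ((∏ i ∈ insert j S, legendreFun (ν i) (y i) : ℝ) : ℂ))
            (by rw [hmp.map_eq]; exact hmi)
          rw [hmp.map_eq] at h1
          exact h1
      _ = _ := by
          rw [integral_prod _ hinteg']
          refine integral_congr_ae (ae_of_all _ fun y => ?_)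
          simp only [Function.comp_apply]
          rw [← integral_mul_const]
          refine integral_congr_ae (ae_of_all _ fun t => ?_)
          simp only
          rw [Finset.prod_insert hj, Function.update_self]
          have : ∏ i ∈ S, legendreFun (ν i) ((Function.update y j t : Cube) i)
              = ∏ i ∈ S, legendreFun (ν i) (y i) :=
            Finset.prod_congr rfl fun i hi => by
              have hne : i ≠ j := by rintro rfl; exact hj hi
              rw [Function.update_of_ne hne]
          rw [this]
          push_cast
          ring

/-- The tensor products of the orthonormal polynomials. -/
noncomputable def tensorLegendre (ν : ℕ →₀ ℕ) (y : Cube) : ℝ :=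
  ∏ j ∈ ν.support, legendreFun (ν j) (y j)

/-- Taking the parameter 1 off the support of `ν` costs nothing in the budget, so the polyellipse
lies in the region where the extension is bounded by 1. -/
theorem abs_integral_mul_tensorLegendre_le {b : ℕ → ℝ} {f : Cube → ℝ}
    (hf : f ∈ unitClass b) (hfm : AEStronglyMeasurable f rho) (ν : ℕ →₀ ℕ) {r : ℕ → ℝ}
    (hr : ∀ j ∈ ν.support, 1 < r j)
    (hsum : ∑ j ∈ ν.support, ((r j + (r j)⁻¹) / 2 - 1) * b j ≤ 1) :
    |∫ y, f y * tensorLegendre ν y ∂rho| ≤ ∏ j ∈ ν.support, coeffBound (r j) (ν j) := by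
  obtain ⟨F, hFd, hFf, hFb⟩ := hf
  have hsub : partialDomain ν.support r ⊆ region b 1 := by
    intro w hw
    have hz : ∀ j ∉ ν.support, (((if j ∈ ν.support then r j else 1) +
        (if j ∈ ν.support then r j else 1)⁻¹) / 2 - 1) * b j = 0 := fun j hj => by
      simp only [if_neg hj]; norm_num
    refine ⟨fun j => if j ∈ ν.support then r j else 1, fun j => ?_, ?_, ?_, fun j => ?_⟩
    · dsimp only; split_ifs with h
      · exact (hr j h).le
      · exact le_rfl
    · exact summable_of_ne_finset_zero (s := ν.support) hz
    · rw [tsum_eq_sum (s := ν.support) hz]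
      refine (le_of_eq (Finset.sum_congr rfl fun j hj => ?_)).trans hsum
      rw [if_pos hj]
    · dsimp only; split_ifs with h
      · exact openEllipse_subset_bernsteinEllipse (hr j h).le (hw.1 j h)
      · obtain ⟨t, ht⟩ := hw.2 j h
        rw [ht]; exact ofReal_mem_bernsteinEllipse_one t.2
  have hF : BoundedHolomorphic ν.support r 1 F := by
    refine ⟨fun w hw j _ => ?_, fun w hw => hFb w (hsub hw)⟩
    have h1 := hFd w (hsub hw) j
    have h2 : (fun z => F (Function.update w j z))
        = (fun h : ℂ => F (w + Pi.single j h)) ∘ fun z => z - w j := by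
      ext z
      simp only [Function.comp_apply]
      congr 1
      ext i
      by_cases hi : i = j
      · subst hi; simp
      · simp [hi]
    rw [h2]
    refine DifferentiableAt.comp _ (by simpa using h1) (by fun_prop)
  have hcf : ∀ y, F (complexify y) = (f y : ℂ) := hFf
  have key := norm_integral_mul_prod_legendreFun_le (ν := ν) ν.support hr
    (fun j hj => Nat.pos_of_ne_zero (Finsupp.mem_support_iff.1 hj)) F 1 hF (by
      simp only [hcf]; exact Complex.continuous_ofReal.comp_aestronglyMeasurable hfm)
  rw [one_mul] at key
  refine (le_of_eq ?_).trans key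
  simp only [hcf, ← Complex.ofReal_mul]
  rw [integral_complex_ofReal, Complex.norm_real]
  rfl

/-- The coefficient bound in terms of admissible weights. -/
theorem abs_integral_mul_tensorLegendre_le_invPow {b : ℕ → ℝ} (hb : ∀ j, 0 < b j) {κ : ℝ}
    (hκ : 1 < κ) {N : ℕ} (hκb : ∀ S : Finset ℕ, (κ - 1) * ∑ j ∈ S, b j ≤ 1)
    (hN : ∀ S : Finset ℕ, (∀ j ∈ S, N ≤ j) → ∑ j ∈ S, b j ≤ 1 / 16)
    {f : Cube → ℝ} (hf : f ∈ unitClass b) (hfm : AEStronglyMeasurable f rho) (ν : ℕ →₀ ℕ)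
    {σ : ℕ → ℝ} (hσ : Admissible b κ N σ) :
    |∫ y, f y * tensorLegendre ν y ∂rho| ≤ (2 / (1 - κ⁻¹)) ^ N * invPow σ ν := by
  -- For `j ≥ N` the factor 4 gains at least `1 / 4`, which absorbs `2 / (1 - r⁻¹)`, as `r ≥ 8`.
  -- Only the first `N` coordinates leave a constant.
  set r : ℕ → ℝ := fun j => if j < N then κ else 4 * σ j with hrdef
  have hr : ∀ j, 1 < r j := fun j => by
    simp only [hrdef]; split_ifs with h
    · exact hκ
    · linarith [hσ.2.1 j (not_lt.1 h)]
  have hκ0 : 0 < 1 - κ⁻¹ := by linarith [inv_lt_one_of_one_lt₀ hκ]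
  have hA : 1 ≤ 2 / (1 - κ⁻¹) := by
    rw [one_le_div hκ0]; linarith [inv_pos.2 (by linarith : 0 < κ)]
  refine (abs_integral_mul_tensorLegendre_le hf hfm ν (fun j _ => hr j) ?_).trans ?_
  · have h1 : ∀ j, ((r j + (r j)⁻¹) / 2 - 1) * b j ≤ (r j - 1) / 2 * b j := fun j => by
      refine mul_le_mul_of_nonneg_right ?_ (hb j).le
      linarith [inv_lt_one_of_one_lt₀ (hr j)]
    refine (Finset.sum_le_sum fun j _ => h1 j).trans ?_
    rw [← Finset.sum_filter_add_sum_filter_not ν.support (· < N)]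
    have h2 : ∑ j ∈ ν.support with j < N, (r j - 1) / 2 * b j ≤ 1 / 2 := by
      have : ∑ j ∈ ν.support with j < N, (r j - 1) / 2 * b j
          = (κ - 1) * (∑ j ∈ ν.support with j < N, b j) / 2 := by
        rw [Finset.mul_sum, Finset.sum_div]
        refine Finset.sum_congr rfl fun j hj => ?_
        simp only [hrdef, (Finset.mem_filter.1 hj).2, if_true]; ring
      rw [this]; linarith [hκb (ν.support.filter (· < N))]
    -- The tail uses `2 * (1 / 8) + 4 * (1 / 16) = 1 / 2`, the other half of the budget.
    have h3 : ∑ j ∈ ν.support with ¬ j < N, (r j - 1) / 2 * b j ≤ 1 / 2 := by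
      have hge : ∀ j ∈ ν.support.filter (¬ · < N), N ≤ j := fun j hj =>
        not_lt.1 (Finset.mem_filter.1 hj).2
      have : ∑ j ∈ ν.support with ¬ j < N, (r j - 1) / 2 * b j
          ≤ 2 * (∑ j ∈ ν.support with ¬ j < N, (σ j - 2) * b j)
            + 4 * ∑ j ∈ ν.support with ¬ j < N, b j := by
        rw [Finset.mul_sum, Finset.mul_sum, ← Finset.sum_add_distrib]
        refine Finset.sum_le_sum fun j hj => ?_
        simp only [hrdef, (Finset.mem_filter.1 hj).2, if_false]
        have := hb j
        nlinarith
      linarith [hσ.2.2 _ hge, hN _ hge]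
    linarith
  · have h1 : ∀ j ∈ ν.support, coeffBound (r j) (ν j)
        ≤ (if j < N then 2 / (1 - κ⁻¹) else 1) * (σ j)⁻¹ ^ ν j := fun j hj => by
      have hνj : 0 < ν j := Nat.pos_of_ne_zero (Finsupp.mem_support_iff.1 hj)
      simp only [coeffBound, hrdef]
      split_ifs with h
      · rw [hσ.1 j h]; exact le_of_eq (by ring)
      · have hσ2 := hσ.2.1 j (not_lt.1 h)
        have h4 : (4 * σ j)⁻¹ ≤ 1 / 8 := by
          rw [inv_le_comm₀ (by linarith) (by norm_num)]; linarith
        have h5 : (4⁻¹ : ℝ) ^ ν j ≤ 4⁻¹ ^ 1 :=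
          pow_le_pow_of_le_one (by norm_num) (by norm_num) hνj
        have h6 : 0 ≤ (σ j)⁻¹ ^ ν j := by positivity
        rw [div_le_iff₀ (by linarith), mul_inv, mul_pow]
        rw [mul_inv] at h4
        nlinarith
    calc ∏ j ∈ ν.support, coeffBound (r j) (ν j)
        ≤ ∏ j ∈ ν.support, ((if j < N then 2 / (1 - κ⁻¹) else 1) * (σ j)⁻¹ ^ ν j) := by
          refine Finset.prod_le_prod (fun j _ => ?_) h1
          have h7 := hr j
          have h8 := inv_lt_one_of_one_lt₀ h7
          rw [coeffBound]
          exact div_nonneg (by positivity) (by linarith)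
      _ = (∏ j ∈ ν.support, if j < N then 2 / (1 - κ⁻¹) else 1) * invPow σ ν := by
          rw [Finset.prod_mul_distrib]; rfl
      _ ≤ _ := by
          refine mul_le_mul_of_nonneg_right ?_ (invPow_pos (hσ.one_le hκ.le) ν).le
          rw [← Finset.prod_filter, Finset.prod_const]
          refine pow_le_pow_right₀ hA ?_
          calc _ ≤ (Finset.range N).card := Finset.card_le_card fun j hj => by
                simpa using (Finset.mem_filter.1 hj).2
            _ = N := Finset.card_range N

end CoefficientBounds

section TensorBasis

/-! ### The orthonormal basis of tensor polynomials -/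

/-- Triangular changes of basis are compatible with tensor products. -/
theorem finsupp_prod_mem_span {A : Type*} [CommRing A] [Algebra ℝ A] {u v : ℕ → ℕ → A}
    (hv : ∀ j, v j 0 = 1)
    (huv : ∀ j n, u j n ∈ Submodule.span ℝ (v j '' Iic n)) (ν : ℕ →₀ ℕ) :
    ν.prod u ∈ Submodule.span ℝ ((fun μ : ℕ →₀ ℕ => μ.prod v) '' Iic ν) := by
  have key : ∀ S : Finset ℕ, ∏ j ∈ S, u j (ν j) ∈
      Submodule.span ℝ ((fun μ : ℕ →₀ ℕ => μ.prod v) '' {μ | μ ≤ ν ∧ μ.support ⊆ S}) := by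
    intro S
    induction S using Finset.induction_on with
    | empty =>
      refine Submodule.subset_span ⟨0, ⟨zero_le, by simp⟩, by simp⟩
    | insert j S hj ih =>
      rw [Finset.prod_insert hj]
      have h := Submodule.mul_mem_mul (huv j (ν j)) ih
      rw [Submodule.span_mul_span] at h
      refine Submodule.span_mono ?_ h
      rintro _ ⟨_, ⟨k, hk, rfl⟩, _, ⟨μ, ⟨hμ, hμS⟩, rfl⟩, rfl⟩
      have hμj : μ j = 0 := by
        by_contra h; exact hj (hμS (Finsupp.mem_support_iff.2 h))
      have hdis : Disjoint (Finsupp.single j k).support μ.support :=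
        Finset.disjoint_left.2 fun i hi hi' => by
          have := Finset.mem_singleton.1 (Finsupp.support_single_subset hi)
          subst this
          exact hj (hμS hi')
      refine ⟨Finsupp.single j k + μ, ⟨fun i => ?_, fun i hi => ?_⟩, ?_⟩
      · by_cases hi : i = j
        · subst hi; simpa [hμj] using hk
        · simpa [Finsupp.single_apply, Ne.symm hi] using hμ i
      · rcases Finset.mem_union.1 (Finsupp.support_add hi) with h | h
        · rw [Finset.mem_singleton.1 (Finsupp.support_single_subset h)]
          exact Finset.mem_insert_self _ _
        · exact Finset.mem_insert_of_mem (hμS h)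
      · simp only
        rw [Finsupp.prod_add_index_of_disjoint hdis, Finsupp.prod_single_index (hv j)]
  exact Submodule.span_mono (image_mono fun μ hμ => hμ.1) (key ν.support)

/-- The coordinate functions on the cube. -/
def coord (j : ℕ) : C(Cube, ℝ) := ⟨fun y => (y j : ℝ), by fun_prop⟩

/-- The tensor products of the orthonormal polynomials, as continuous functions. -/
noncomputable def tensorC (ν : ℕ →₀ ℕ) : C(Cube, ℝ) :=
  ν.prod fun j n => Polynomial.aeval (coord j) (legendre n)

/-- The monomials, as continuous functions. -/
noncomputable def monomialC (ν : ℕ →₀ ℕ) : C(Cube, ℝ) := ν.prod fun j n => coord j ^ n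

theorem tensorC_apply (ν : ℕ →₀ ℕ) (y : Cube) : tensorC ν y = tensorLegendre ν y := by
  simp only [tensorC, Finsupp.prod, ContinuousMap.coe_prod, Finset.prod_apply, tensorLegendre]
  refine Finset.prod_congr rfl fun j _ => ?_
  rw [Polynomial.aeval_continuousMap_apply]
  rfl

theorem monomialC_apply (ν : ℕ →₀ ℕ) (y : Cube) :
    monomialC ν y = ν.prod fun j n => (y j : ℝ) ^ n := by
  simp [monomialC, Finsupp.prod, coord]

theorem tensorC_mem_span (ν : ℕ →₀ ℕ) :
    tensorC ν ∈ Submodule.span ℝ (monomialC '' Iic ν) := by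
  refine finsupp_prod_mem_span (u := fun j n => Polynomial.aeval (coord j) (legendre n))
    (v := fun j n => coord j ^ n) (fun j => by simp)
    (fun j n => ?_) ν
  have := Submodule.apply_mem_span_image_of_mem_span (Polynomial.aeval (coord j)).toLinearMap
    (legendre_mem_span n)
  rw [← image_comp] at this
  simpa [Function.comp_def] using this

theorem monomialC_mem_span (ν : ℕ →₀ ℕ) :
    monomialC ν ∈ Submodule.span ℝ (range tensorC) := by
  refine Submodule.span_mono (image_subset_range _ (Iic ν)) ?_
  refine finsupp_prod_mem_span (v := fun j n => Polynomial.aeval (coord j) (legendre n))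
    (u := fun j n => coord j ^ n) (fun j => by simp [legendre_zero])
    (fun j n => ?_) ν
  have := Submodule.apply_mem_span_image_of_mem_span (Polynomial.aeval (coord j)).toLinearMap
    (X_pow_mem_span_legendre n)
  rw [← image_comp] at this
  simpa [Function.comp_def] using this

/-- Stone–Weierstrass: the coordinates separate points of the compact cube, and every monomial lies
in the span of the tensor polynomials. -/
theorem span_tensorC_closure_eq_top :
    (Submodule.span ℝ (range tensorC)).topologicalClosure = ⊤ := by
  have hsep : (Algebra.adjoin ℝ (range coord)).SeparatesPoints := by
    intro x y hxy
    obtain ⟨j, hj⟩ := Function.ne_iff.1 hxy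
    refine ⟨coord j, ⟨coord j, Algebra.subset_adjoin ⟨j, rfl⟩, rfl⟩, fun h => hj ?_⟩
    exact Subtype.ext h
  have htop := ContinuousMap.subalgebra_topologicalClosure_eq_top_of_separatesPoints _ hsep
  have hle : Subalgebra.toSubmodule (Algebra.adjoin ℝ (range coord))
      ≤ Submodule.span ℝ (range tensorC) := by
    rw [Algebra.adjoin_eq_span, Submodule.span_le]
    intro g hg
    have : ∃ ν, monomialC ν = g := by
      induction hg using Submonoid.closure_induction with
      | mem g hg =>
        obtain ⟨j, rfl⟩ := hg
        exact ⟨Finsupp.single j 1, by simp [monomialC]⟩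
      | one => exact ⟨0, by simp [monomialC]⟩
      | mul g h _ _ hg hh =>
        obtain ⟨ν, rfl⟩ := hg
        obtain ⟨μ, rfl⟩ := hh
        exact ⟨ν + μ, Finsupp.prod_add_index' (by simp) (fun j => pow_add _)⟩
    obtain ⟨ν, rfl⟩ := this
    exact monomialC_mem_span ν
  refine top_le_iff.1 (le_trans ?_ (Submodule.topologicalClosure_mono hle))
  intro g _
  have : g ∈ (Algebra.adjoin ℝ (range coord)).topologicalClosure := by rw [htop]; trivial
  exact this

theorem integral_prod_rho (S : Finset ℕ) {h : ℕ → Icc (-1 : ℝ) 1 → ℝ}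
    (hc : ∀ j, Continuous (h j)) :
    ∫ y, ∏ j ∈ S, h j (y j) ∂rho = ∏ j ∈ S, ∫ x, h j x ∂unif := by
  have h1 := integral_restrict_infinitePi (fun _ : ℕ => unif) (s := S)
    (f := fun y : (i : S) → Icc (-1 : ℝ) 1 => ∏ i : S, h i (y i))
    (Continuous.aestronglyMeasurable (continuous_finsetProd _ fun i _ =>
      (hc i).comp (continuous_apply i)))
  rw [integral_fintype_prod_eq_prod (fun i : S => h i), Finset.prod_coe_sort S
    (fun j => ∫ x, h j x ∂unif)] at h1
  rw [← h1]
  refine integral_congr_ae (ae_of_all _ fun y => ?_)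
  exact (Finset.prod_coe_sort S fun j => h j (y j)).symm

theorem integral_tensorLegendre_mul (ν μ : ℕ →₀ ℕ) :
    ∫ y, tensorLegendre ν y * tensorLegendre μ y ∂rho = if ν = μ then 1 else 0 := by
  set S := ν.support ∪ μ.support
  have hS : ∀ (η : ℕ →₀ ℕ), η.support ⊆ S → ∀ y,
      tensorLegendre η y = ∏ j ∈ S, legendreFun (η j) (y j) := fun η hη y => by
    refine Finset.prod_subset hη fun j _ hj => ?_
    rw [Finsupp.notMem_support_iff.1 hj, legendreFun, legendre_zero, Polynomial.eval_one]
  simp_rw [hS ν Finset.subset_union_left, hS μ Finset.subset_union_right,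
    ← Finset.prod_mul_distrib]
  rw [integral_prod_rho S (h := fun j x => legendreFun (ν j) x * legendreFun (μ j) x)
    fun j => ((continuous_legendreFun _).comp continuous_subtype_val).mul
      ((continuous_legendreFun _).comp continuous_subtype_val)]
  have : ∀ j, ∫ x : Icc (-1 : ℝ) 1, legendreFun (ν j) x * legendreFun (μ j) x ∂unif
      = if ν j = μ j then 1 else 0 := fun j => integral_legendre_mul _ _
  simp_rw [this]
  split_ifs with h
  · subst h; simp
  · obtain ⟨j, hj⟩ := Finsupp.ne_iff.1 h
    refine Finset.prod_eq_zero (i := j) ?_ (if_neg hj)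
    by_contra hjS
    simp only [S, Finset.mem_union, not_or, Finsupp.notMem_support_iff] at hjS
    exact hj (by rw [hjS.1, hjS.2])

/-- The orthonormal basis of `L²` consisting of tensor polynomials. -/
noncomputable def tensorLp (ν : ℕ →₀ ℕ) : Lp ℝ 2 rho := ContinuousMap.toLp 2 rho ℝ (tensorC ν)

theorem orthonormal_tensorLp : Orthonormal ℝ tensorLp := by
  rw [orthonormal_iff_ite]
  intro ν μ
  rw [tensorLp, tensorLp, ContinuousMap.inner_toLp, ← integral_tensorLegendre_mul]
  refine integral_congr_ae (ae_of_all _ fun y => ?_)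
  simp [tensorC_apply, mul_comm]

theorem span_tensorLp_closure_eq_top :
    ⊤ ≤ (Submodule.span ℝ (range tensorLp)).topologicalClosure := by
  have h := (ContinuousMap.toLp_denseRange ℝ rho ℝ
    (p := 2) (by norm_num)).topologicalClosure_map_submodule span_tensorC_closure_eq_top
  rw [Submodule.map_span, ← range_comp] at h
  exact h.ge

/-- If the coefficients outside a finite lower set are small, then the function is close to a
polynomial with exponents in that set. -/
theorem exists_monomials_eLpNorm_le {Λ : Finset (ℕ →₀ ℕ)} (hΛ : ∀ ν ∈ Λ, ∀ μ ≤ ν, μ ∈ Λ)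
    {f : Cube → ℝ} (hf : MemLp f 2 rho) {T : ℝ} (hT0 : 0 ≤ T)
    (hT : ∀ u : Finset (ℕ →₀ ℕ), Disjoint u Λ →
      ∑ ν ∈ u, (∫ y, f y * tensorLegendre ν y ∂rho) ^ 2 ≤ T ^ 2) :
    ∃ d : (ℕ →₀ ℕ) → ℝ,
      eLpNorm (fun y => f y - ∑ ν ∈ Λ, d ν * ν.prod fun j n => (y j : ℝ) ^ n) 2 rho
        ≤ ENNReal.ofReal T := by
  classical
  let B := HilbertBasis.mk orthonormal_tensorLp span_tensorLp_closure_eq_top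
  have hB : ⇑B = tensorLp := HilbertBasis.coe_mk _ _
  set c : (ℕ →₀ ℕ) → ℝ := fun ν => ∫ y, f y * tensorLegendre ν y ∂rho with hc
  have hinner : ∀ ν, inner ℝ (tensorLp ν) (hf.toLp f) = c ν := by
    intro ν
    rw [L2.inner_def]
    refine integral_congr_ae ?_
    filter_upwards [hf.coeFn_toLp, ContinuousMap.coeFn_toLp (p := 2) (𝕜 := ℝ) rho (tensorC ν)]
      with y h1 h2
    rw [h1, tensorLp, h2, tensorC_apply]
    simp
  set g := hf.toLp f - ∑ ν ∈ Λ, c ν • tensorLp ν with hg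
  have hgi : ∀ μ, inner ℝ (tensorLp μ) g = if μ ∈ Λ then 0 else c μ := by
    intro μ
    rw [hg, inner_sub_right, hinner, inner_sum]
    simp only [inner_smul_right, orthonormal_iff_ite.1 orthonormal_tensorLp]
    split_ifs with h <;> simp [h]
  -- Parseval: the squared norm of the remainder is the sum of the squared coefficients outside `Λ`.
  have hgnorm : ‖g‖ ^ 2 ≤ T ^ 2 := by
    have h1 := B.hasSum_inner_mul_inner g g
    rw [real_inner_self_eq_norm_sq] at h1
    refine hasSum_le_of_sum_le h1 fun u => ?_
    rw [hB]
    calc ∑ ν ∈ u, inner ℝ g (tensorLp ν) * inner ℝ (tensorLp ν) g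
        = ∑ ν ∈ u, if ν ∈ Λ then 0 else c ν ^ 2 := by
          refine Finset.sum_congr rfl fun ν _ => ?_
          rw [real_inner_comm, hgi]
          split_ifs <;> ring
      _ = ∑ ν ∈ u \ Λ, c ν ^ 2 := by
          rw [Finset.sdiff_eq_filter, Finset.sum_filter]
          exact Finset.sum_congr rfl fun ν _ => by split_ifs <;> simp_all
      _ ≤ T ^ 2 := hT _ Finset.sdiff_disjoint
  have hgT : ‖g‖ ≤ T := by
    exact (sq_le_sq₀ (norm_nonneg _) hT0).1 hgnorm
  -- Lowerness enters here: expanding a tensor polynomial in monomials only produces smaller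
  -- exponents.
  have hspan : ∑ ν ∈ Λ, c ν • tensorC ν ∈ Submodule.span ℝ (monomialC '' (Λ : Set (ℕ →₀ ℕ))) := by
    refine Submodule.sum_mem _ fun ν hν => Submodule.smul_mem _ _ ?_
    exact Submodule.span_mono (image_mono fun μ hμ => hΛ ν hν μ hμ) (tensorC_mem_span ν)
  obtain ⟨d, hd⟩ := (Submodule.mem_span_image_finset_iff_exists_fun ℝ).1 hspan
  refine ⟨fun ν => if h : ν ∈ Λ then d ⟨ν, h⟩ else 0, ?_⟩
  have hpoly : ∀ y : Cube, (∑ ν ∈ Λ, (if h : ν ∈ Λ then d ⟨ν, h⟩ else 0) *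
      ν.prod fun j n => (y j : ℝ) ^ n) = (∑ ν ∈ Λ, c ν • tensorC ν) y := by
    intro y
    rw [← hd, ContinuousMap.coe_sum, Finset.sum_apply, ← Finset.sum_coe_sort Λ]
    refine Finset.sum_congr rfl fun ν _ => ?_
    rw [dif_pos ν.2, ContinuousMap.smul_apply, monomialC_apply, smul_eq_mul]
  have hge : g = hf.toLp f - ContinuousMap.toLp 2 rho ℝ (∑ ν ∈ Λ, c ν • tensorC ν) := by
    rw [hg, map_sum]; simp only [map_smul, tensorLp]
  have hae : (fun y => f y - ∑ ν ∈ Λ, (if h : ν ∈ Λ then d ⟨ν, h⟩ else 0) *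
      ν.prod fun j n => (y j : ℝ) ^ n) =ᵐ[rho] g := by
    rw [hge]
    filter_upwards [Lp.coeFn_sub (hf.toLp f)
      (ContinuousMap.toLp 2 rho ℝ (∑ ν ∈ Λ, c ν • tensorC ν)), hf.coeFn_toLp,
      ContinuousMap.coeFn_toLp (p := 2) (𝕜 := ℝ) rho (∑ ν ∈ Λ, c ν • tensorC ν)] with y h1 h2 h3
    rw [h1, Pi.sub_apply, h2, h3, hpoly]
  rw [eLpNorm_congr_ae hae, ← Lp.enorm_def, ← ofReal_norm]
  exact ENNReal.ofReal_le_ofReal hgT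

end TensorBasis

section Assembly

/-! ### Assembling the approximation theorem -/

theorem exists_tail_sum_le {a : ℕ → ℝ} (ha : Summable a) {ε : ℝ} (hε : 0 < ε) :
    ∃ N : ℕ, ∀ M, N ≤ M → ∀ S : Finset ℕ, (∀ j ∈ S, M ≤ j) → ∑ j ∈ S, a j ≤ ε := by
  obtain ⟨s, hs⟩ := summable_iff_vanishing_norm.1 ha ε hε
  refine ⟨s.sup id + 1, fun M hM S hS => ?_⟩
  refine (le_abs_self _).trans (hs S (Finset.disjoint_left.2 fun j hj hj' => ?_)).le
  have h1 : j ≤ s.sup id := Finset.le_sup (f := id) hj'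
  have h2 := hS j hj
  omega

theorem summable_rpow_of_memℓp {b : ℕ → ℝ} (hb : ∀ j, 0 ≤ b j) {p : ℝ} (hp : 0 < p)
    (h : Memℓp b (ENNReal.ofReal p)) : Summable fun j => b j ^ p := by
  have h1 := (memℓp_gen_iff (by rwa [ENNReal.toReal_ofReal hp.le])).1 h
  rw [ENNReal.toReal_ofReal hp.le] at h1
  refine h1.congr fun j => ?_
  rw [Real.norm_of_nonneg (hb j)]

theorem summable_of_memℓp {b : ℕ → ℝ} (hb : ∀ j, 0 ≤ b j) {p : ℝ} (hp1 : p < 1)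
    (h : Memℓp b (ENNReal.ofReal p)) : Summable b := by
  have h1 : Memℓp b (ENNReal.ofReal 1) := h.of_exponent_ge (ENNReal.ofReal_le_ofReal hp1.le)
  simpa using summable_rpow_of_memℓp hb one_pos h1

theorem abs_le_one_of_mem_unitClass {b : ℕ → ℝ} {f : Cube → ℝ} (hf : f ∈ unitClass b) (y : Cube) :
    |f y| ≤ 1 := by
  obtain ⟨F, -, hFf, hFb⟩ := hf
  have := hFb (fun j => ((y j : ℝ) : ℂ)) ⟨fun _ => 1, fun _ => le_rfl, by
    norm_num, by norm_num, fun j => ofReal_mem_bernsteinEllipse_one (y j).2⟩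
  rwa [hFf, Complex.norm_real] at this

/-- Larger weights allow fewer polyellipses, so the extension has less to satisfy. Hence `b` may be
replaced by any majorant. -/
theorem unitClass_mono {b b' : ℕ → ℝ} (hb : ∀ j, 0 ≤ b j) (h : ∀ j, b j ≤ b' j) :
    unitClass b ⊆ unitClass b' := by
  have hsub : region b' 1 ⊆ region b 1 := by
    rintro w ⟨r, hr, hsum, hle, hw⟩
    have h0 : ∀ j, 0 ≤ (r j + (r j)⁻¹) / 2 - 1 := fun j => by
      have hrj : 0 < r j := by linarith [hr j]
      have : (r j + (r j)⁻¹) / 2 - 1 = (r j - 1) ^ 2 / (2 * r j) := by field_simp; ring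
      rw [this]; positivity
    have hle' : ∀ j, ((r j + (r j)⁻¹) / 2 - 1) * b j ≤ ((r j + (r j)⁻¹) / 2 - 1) * b' j :=
      fun j => mul_le_mul_of_nonneg_left (h j) (h0 j)
    have hs := Summable.of_nonneg_of_le (fun j => mul_nonneg (h0 j) (hb j)) hle' hsum
    exact ⟨r, hr, hs, (hs.tsum_le_tsum hle' hsum).trans hle, hw⟩
  rintro f ⟨F, hd, hf, hb⟩
  exact ⟨F, fun z hz => hd z (hsub hz), hf, fun z hz => hb z (hsub hz)⟩

/-- Approximation by polynomials with exponents in a lower set. -/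
theorem exists_polynomial_approximation {b : ℕ → ℝ} (hb : ∀ j, 0 < b j) {p : ℝ} (hp : 0 < p)
    (hp1 : p < 1) (hbp : Memℓp b (ENNReal.ofReal p)) :
    ∃ C : ℝ, 0 ≤ C ∧ ∀ s : ℕ, 1 ≤ s → ∃ Λ : Finset (ℕ →₀ ℕ), Λ.card ≤ s ∧
      (∀ ν ∈ Λ, ∀ μ ≤ ν, μ ∈ Λ) ∧
      (Antitone b → ∀ i j, i ≤ j → Finsupp.single j 1 ∈ Λ → Finsupp.single i 1 ∈ Λ) ∧
      ∀ f ∈ unitClass b, AEStronglyMeasurable f rho → ∃ d : (ℕ →₀ ℕ) → ℝ,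
        eLpNorm (fun y => f y - ∑ ν ∈ Λ, d ν * ν.prod fun j n => (y j : ℝ) ^ n) 2 rho
          ≤ ENNReal.ofReal (C * (s : ℝ) ^ (1 / 2 - 1 / p)) := by
  have hb0 : ∀ j, 0 ≤ b j := fun j => (hb j).le
  have hs1 := summable_of_memℓp hb0 hp1 hbp
  have hsp : Summable fun j => (8 * Real.exp 1 * b j) ^ p := by
    refine ((summable_rpow_of_memℓp hb0 hp hbp).mul_left ((8 * Real.exp 1) ^ p)).congr fun j => ?_
    rw [Real.mul_rpow (by positivity) (hb0 j)]
  obtain ⟨N₁, hN₁⟩ := exists_tail_sum_le hs1 (ε := 1 / 16) (by norm_num)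
  obtain ⟨N₂, hN₂⟩ := exists_tail_sum_le hsp (ε := 1 / 2) (by norm_num)
  set N := max N₁ N₂
  set B := ∑' j, b j
  have hB : 0 ≤ B := tsum_nonneg hb0
  -- Chosen so that `(κ - 1) * B ≤ 1` and `1 < κ ≤ 2`.
  set κ := 1 + 1 / (1 + B) with hκdef
  have hκ : 1 < κ := by
    have : 0 < 1 / (1 + B) := by positivity
    linarith
  have hκ2 : κ ≤ 2 := by
    have : 1 / (1 + B) ≤ 1 := by rw [div_le_one (by positivity)]; linarith
    linarith
  have hκb : ∀ S : Finset ℕ, (κ - 1) * ∑ j ∈ S, b j ≤ 1 := fun S => by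
    have h1 : ∑ j ∈ S, b j ≤ B := hs1.sum_le_tsum S fun j _ => hb0 j
    rw [hκdef, add_sub_cancel_left, one_div_mul_eq_div, div_le_one (by positivity)]
    linarith
  have hκ0 : 0 < 1 - κ⁻¹ := by linarith [inv_lt_one_of_one_lt₀ hκ]
  obtain ⟨C, hC, hmain⟩ := exists_lower_set hb hκ hκ2 (C₀ := (2 / (1 - κ⁻¹)) ^ N) (by positivity)
    hp hp1 (hN₂ N (le_max_right _ _))
  refine ⟨C, hC, fun s hs => ?_⟩
  obtain ⟨Λ, hcard, hlow, hanc, hc⟩ := hmain s hs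
  refine ⟨Λ, hcard, hlow, hanc, fun f hf hfm => ?_⟩
  have hmem : MemLp f 2 rho := MemLp.of_bound hfm 1
    (ae_of_all _ fun y => abs_le_one_of_mem_unitClass hf y)
  refine exists_monomials_eLpNorm_le hlow hmem (by positivity) fun u hu => ?_
  exact hc _ (fun ν σ hσ => abs_integral_mul_tensorLegendre_le_invPow hb hκ hκb
    (hN₁ N (le_max_left _ _)) hf hfm ν hσ) u hu

/-! ### Degrees and active variables of lower sets -/

theorem one_add_sum_le_prod {ι : Type*} (S : Finset ι) (a : ι → ℕ) :
    1 + ∑ i ∈ S, a i ≤ ∏ i ∈ S, (a i + 1) := by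
  classical
  induction S using Finset.induction_on with
  | empty => simp
  | insert i S hi ih =>
    rw [Finset.sum_insert hi, Finset.prod_insert hi]
    calc 1 + (a i + ∑ j ∈ S, a j) ≤ (a i + 1) * (1 + ∑ j ∈ S, a j) := by
          nlinarith [Nat.zero_le (a i * ∑ j ∈ S, a j)]
      _ ≤ _ := Nat.mul_le_mul_left _ ih

/-- The whole box below `ν` lies in `Λ` and has `∏ (ν j + 1) ≥ 1 + |ν|` elements. This degree bound
is what makes a tree of height `⌈log₂ s⌉` sufficient. -/
theorem degree_lt_card_of_lower {Λ : Finset (ℕ →₀ ℕ)} (hΛ : ∀ ν ∈ Λ, ∀ μ ≤ ν, μ ∈ Λ)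
    {ν : ℕ →₀ ℕ} (hν : ν ∈ Λ) : ν.degree < Λ.card := by
  have h1 : (Finset.Iic ν).card ≤ Λ.card :=
    Finset.card_le_card fun μ hμ => hΛ ν hν μ (Finset.mem_Iic.1 hμ)
  rw [Finsupp.card_Iic] at h1
  simp only [Nat.card_Iic] at h1
  have h2 := one_add_sum_le_prod ν.support ν
  have h3 : ν.degree = ∑ j ∈ ν.support, ν j := rfl
  omega

theorem single_mem_of_lower {Λ : Finset (ℕ →₀ ℕ)} (hΛ : ∀ ν ∈ Λ, ∀ μ ≤ ν, μ ∈ Λ) {j : ℕ}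
    (hj : j ∈ Λ.biUnion Finsupp.support) : Finsupp.single j 1 ∈ Λ := by
  obtain ⟨ν, hν, hjν⟩ := Finset.mem_biUnion.1 hj
  refine hΛ ν hν _ (Finsupp.single_le_iff.2 ?_)
  exact Nat.one_le_iff_ne_zero.2 (Finsupp.mem_support_iff.1 hjν)

theorem card_le_of_forall_single_mem {Λ : Finset (ℕ →₀ ℕ)} {S : Finset ℕ}
    (h : ∀ j ∈ S, Finsupp.single j 1 ∈ Λ) : S.card ≤ Λ.card :=
  Finset.card_le_card_of_injOn (fun j => Finsupp.single j 1) h fun _ _ _ _ hij =>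
    Finsupp.single_left_injective one_ne_zero hij

/-- The variables of a lower set, completed to a set of `s` variables. -/
theorem exists_variables {Λ : Finset (ℕ →₀ ℕ)} {s : ℕ} (hcard : Λ.card ≤ s)
    (hΛ : ∀ ν ∈ Λ, ∀ μ ≤ ν, μ ∈ Λ) {P : Prop}
    (hP : P → ∀ i j, i ≤ j → Finsupp.single j 1 ∈ Λ → Finsupp.single i 1 ∈ Λ) :
    ∃ Θ : Finset ℕ, Θ.card = s ∧ (P → Θ = Finset.range s) ∧ ∀ ν ∈ Λ, ν.support ⊆ Θ := by
  have hsub : ∀ ν ∈ Λ, ν.support ⊆ Λ.biUnion Finsupp.support := fun ν hν =>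
    Finset.subset_biUnion_of_mem Finsupp.support hν
  by_cases h : P
  · refine ⟨Finset.range s, Finset.card_range s, fun _ => rfl, fun ν hν j hj => ?_⟩
    have h1 := single_mem_of_lower hΛ (hsub ν hν hj)
    -- An active variable `j` forces the `j + 1` unit multi-indices up to `j` into `Λ`, whence `j <
    -- s`.
    have h2 := card_le_of_forall_single_mem (Λ := Λ) (S := Finset.range (j + 1)) fun i hi =>
      hP h i j (Nat.lt_succ_iff.1 (Finset.mem_range.1 hi)) h1
    rw [Finset.card_range] at h2
    exact Finset.mem_range.2 (by omega)
  · obtain ⟨Θ, hΘ, hc⟩ := Infinite.exists_superset_card_eq (Λ.biUnion Finsupp.support) s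
      ((card_le_of_forall_single_mem fun j hj => single_mem_of_lower hΛ hj).trans hcard)
    exact ⟨Θ, hc, fun hp => absurd hp h, fun ν hν => (hsub ν hν).trans hΘ⟩

theorem prod_restrictVars {Θ : Finset ℕ} {s : ℕ} (hΘ : Θ.card = s) {ν : ℕ →₀ ℕ}
    (hν : ν.support ⊆ Θ) (y : Cube) :
    ∏ i, restrictVars Θ hΘ y i ^ ν (Θ.orderEmbOfFin hΘ i) = ν.prod fun j n => (y j : ℝ) ^ n := by
  rw [Finsupp.prod_of_support_subset ν hν _ (by simp)]
  conv_rhs => rw [← Finset.map_orderEmbOfFin_univ Θ hΘ, Finset.prod_map]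
  rfl

theorem sum_restrict_eq_degree {Θ : Finset ℕ} {s : ℕ} (hΘ : Θ.card = s) {ν : ℕ →₀ ℕ}
    (hν : ν.support ⊆ Θ) : ∑ i, ν (Θ.orderEmbOfFin hΘ i) = ν.degree := by
  rw [Finsupp.degree]
  refine Eq.trans ?_ (Finset.sum_subset hν (by simp)).symm
  conv_rhs => rw [← Finset.map_orderEmbOfFin_univ Θ hΘ, Finset.sum_map]
  rfl

theorem norm_restrictVars_le {Θ : Finset ℕ} {s : ℕ} (hΘ : Θ.card = s) (y : Cube) :
    ‖restrictVars Θ hΘ y‖ ≤ 1 := by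
  rw [pi_norm_le_iff_of_nonneg zero_le_one]
  intro i
  exact abs_le.2 (y _).2

theorem exists_tanhDNN_approximation {b : ℕ → ℝ} (hb : ∀ j, 0 < b j) {p : ℝ} (hp : 0 < p)
    (hp1 : p < 1) (hbp : Memℓp b (ENNReal.ofReal p)) :
    ∃ C : ℝ, ∀ (s : ℕ) (hs : 1 ≤ s), ∃ (Θ : Finset ℕ) (hΘ : Θ.card = s),
      (Antitone b → Θ = Finset.range s) ∧
      ∀ f ∈ unitClass b, AEStronglyMeasurable f rho →
        ∃ Φ ∈ tanhDNN s 1 (treeArchitecture s hs),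
          eLpNorm (fun y => f y - Φ (restrictVars Θ hΘ y) 0) 2 rho
            ≤ ENNReal.ofReal (C * (s : ℝ) ^ (1 / 2 - 1 / p)) := by
  obtain ⟨C, hC, hmain⟩ := exists_polynomial_approximation hb hp hp1 hbp
  refine ⟨C + 1, fun s hs => ?_⟩
  obtain ⟨Λ, hcard, hlow, hanc, hpoly⟩ := hmain s hs
  obtain ⟨Θ, hΘ, hΘr, hsupp⟩ := exists_variables hcard hlow hanc
  refine ⟨Θ, hΘ, hΘr, fun f hf hfm => ?_⟩
  obtain ⟨d, hd⟩ := hpoly f hf hfm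
  have hs0 : (0 : ℝ) < s := by exact_mod_cast hs
  set ε := (s : ℝ) ^ (1 / 2 - 1 / p)
  have hε : 0 < ε := by positivity
  -- The network error is taken equal to the rate itself, which raises the constant from `C` to `C +
  -- 1`.
  obtain ⟨Φ, hΦ, hΦa⟩ := exists_tanhDNN_monomials hs Λ hcard
    (fun ν i => ν (Θ.orderEmbOfFin hΘ i))
    (fun ν hν => by
      rw [sum_restrict_eq_degree hΘ (hsupp ν hν)]
      exact (degree_lt_card_of_lower hlow hν).le.trans hcard) d 1 hε
  refine ⟨Φ, hΦ, ?_⟩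
  set q : Cube → ℝ := fun y => ∑ ν ∈ Λ, d ν * ν.prod fun j n => (y j : ℝ) ^ n with hq
  have hqc : Continuous q := by
    refine continuous_finsetSum _ fun ν _ => continuous_const.mul ?_
    exact continuous_finsetProd _ fun j _ => by fun_prop
  have hqΦ : ∀ y, |Φ (restrictVars Θ hΘ y) 0 - q y| ≤ ε := fun y => by
    have h1 := hΦa _ (norm_restrictVars_le hΘ y)
    refine (le_of_eq (congrArg _ (congrArg _ ?_))).trans h1
    exact Finset.sum_congr rfl fun ν hν => by rw [prod_restrictVars hΘ (hsupp ν hν)]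
  have hm : AEStronglyMeasurable (fun y => f y - q y) rho := hfm.sub hqc.aestronglyMeasurable
  calc eLpNorm (fun y => f y - Φ (restrictVars Θ hΘ y) 0) 2 rho
      ≤ eLpNorm ((fun y => ‖f y - q y‖) + fun _ => ε) 2 rho := by
        refine eLpNorm_mono_real fun y => ?_
        have h1 := abs_add_le (f y - q y) (q y - Φ (restrictVars Θ hΘ y) 0)
        rw [sub_add_sub_cancel, abs_sub_comm (q y)] at h1
        simp only [Pi.add_apply, Real.norm_eq_abs]
        linarith [hqΦ y]
    _ ≤ eLpNorm (fun y => ‖f y - q y‖) 2 rho + eLpNorm (fun _ : Cube => ε) 2 rho :=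
        eLpNorm_add_le hm.norm aestronglyMeasurable_const (by norm_num)
    _ ≤ ENNReal.ofReal (C * ε) + ENNReal.ofReal ε := by
        refine add_le_add ?_ ?_
        · rw [eLpNorm_norm]; exact hd
        · rw [eLpNorm_const _ (by norm_num) (IsProbabilityMeasure.ne_zero rho)]
          simp [Real.enorm_eq_ofReal hε.le]
    _ = ENNReal.ofReal ((C + 1) * ε) := by
        rw [← ENNReal.ofReal_add (by positivity) hε.le]; congr 1; ring

/-! ### Positive monotone majorants -/

theorem memℓp_half_pow {p : ℝ} (hp : 0 < p) :
    Memℓp (fun j : ℕ => (1 / 2 : ℝ) ^ j) (ENNReal.ofReal p) := by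
  refine memℓp_gen ?_
  rw [ENNReal.toReal_ofReal hp.le]
  have h := summable_geometric_of_lt_one (r := (1 / 2 : ℝ) ^ p) (by positivity)
    (Real.rpow_lt_one (by norm_num) (by norm_num) hp)
  refine h.congr fun j => ?_
  rw [Real.norm_of_nonneg (by positivity), ← Real.rpow_natCast, ← Real.rpow_natCast,
    ← Real.rpow_mul (by norm_num), ← Real.rpow_mul (by norm_num), mul_comm]

theorem bddAbove_range_abs {z : ℕ → ℝ} (hz : Memℓp z ∞) (i : ℕ) :
    BddAbove (range fun j : Ici i => |z j|) := by
  obtain ⟨B, hB⟩ := memℓp_infty_iff.1 hz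
  exact ⟨B, by rintro _ ⟨j, rfl⟩; exact hB ⟨j, rfl⟩⟩

theorem abs_le_monotoneMajorant {z : ℕ → ℝ} (hz : Memℓp z ∞) (i : ℕ) :
    |z i| ≤ monotoneMajorant z i :=
  le_ciSup (bddAbove_range_abs hz i) ⟨i, mem_Ici.2 le_rfl⟩

theorem antitone_monotoneMajorant {z : ℕ → ℝ} (hz : Memℓp z ∞) :
    Antitone (monotoneMajorant z) := fun i _ hik =>
  ciSup_le fun j => le_ciSup (f := fun j : Ici i => |z j|) (bddAbove_range_abs hz i)
    ⟨j, mem_Ici.2 (hik.trans j.2)⟩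

/-- A positive `ℓ^p` majorant, which is monotone if `b` is in the monotone `ℓ^p` space. -/
theorem exists_positive_majorant {b : ℕ → ℝ} (hb : ∀ j, 0 ≤ b j) {p : ℝ} (hp : 0 < p)
    (hbp : Memℓp b (ENNReal.ofReal p)) :
    ∃ b' : ℕ → ℝ, (∀ j, b j ≤ b' j) ∧ (∀ j, 0 < b' j) ∧ Memℓp b' (ENNReal.ofReal p) ∧
      (MemMonotoneLp b p → Antitone b') := by
  have hpos : ∀ j : ℕ, 0 < (1 / 2 : ℝ) ^ j := fun j => by positivity
  by_cases h : MemMonotoneLp b p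
  · have hle : ∀ j, b j ≤ monotoneMajorant b j := fun j =>
      (le_abs_self _).trans (abs_le_monotoneMajorant h.1 j)
    -- The geometric term makes the weights strictly positive, as the division by `b j` in the
    -- choice of radii requires, and preserves both `ℓ^p` and monotonicity.
    refine ⟨fun j => monotoneMajorant b j + (1 / 2 : ℝ) ^ j, fun j => ?_, fun j => ?_,
      h.2.add (memℓp_half_pow hp), fun _ => ?_⟩
    · linarith [hle j, hpos j]
    · linarith [hle j, hpos j, hb j]
    · exact (antitone_monotoneMajorant h.1).add
        (pow_right_anti₀ (by norm_num) (by norm_num))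
  · refine ⟨fun j => b j + (1 / 2 : ℝ) ^ j, fun j => ?_, fun j => ?_,
      hbp.add (memℓp_half_pow hp), fun h' => absurd h' h⟩
    · linarith [hpos j]
    · linarith [hpos j, hb j]

end Assembly

end HoloDNN


theorem mainTheorem4 :
    ∃ c₁ > (0 : ℝ), ∃ c₂ > (0 : ℝ),
      ∀ (p : ℝ), 0 < p → p < 1 →
      ∀ (b : ℕ → ℝ), (∀ j, 0 ≤ b j) → Memℓp b (ENNReal.ofReal p) →
      ∃ C : ℝ, ∀ s : ℕ, 1 ≤ s →
        ∃ (Θ : Finset ℕ) (hΘ : Θ.card = s) (a : HoloDNN.Architecture),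
          (HoloDNN.MemMonotoneLp b p → Θ = Finset.range s) ∧
          (a.width : ℝ) ≤ c₁ * (s : ℝ) ^ 2 ∧
          (a.depth : ℝ) ≤ c₂ * Real.log s ∧
          ∀ f ∈ HoloDNN.unitClass b, AEStronglyMeasurable f HoloDNN.rho →
            ∃ Φ ∈ HoloDNN.tanhDNN s 1 a,
              eLpNorm (fun y => f y - Φ (HoloDNN.restrictVars Θ hΘ y) 0) 2 HoloDNN.rho
                ≤ ENNReal.ofReal (C * (s : ℝ) ^ (1 / 2 - 1 / p)) := by
  refine ⟨4, by norm_num, 2 / Real.log 2, div_pos two_pos (Real.log_pos one_lt_two), ?_⟩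
  intro p hp hp1 b hb hbp
  obtain ⟨b', hle, hpos, hbp', hanti⟩ := HoloDNN.exists_positive_majorant hb hp hbp
  obtain ⟨C, hC⟩ := HoloDNN.exists_tanhDNN_approximation hpos hp hp1 hbp'
  refine ⟨C, fun s hs => ?_⟩
  obtain ⟨Θ, hΘ, hΘr, happ⟩ := hC s hs
  exact ⟨Θ, hΘ, HoloDNN.treeArchitecture s hs, fun h => hΘr (hanti h),
    HoloDNN.treeArchitecture_width_le s hs, HoloDNN.treeArchitecture_depth_le s hs,
    fun f hf hfm => happ f (HoloDNN.unitClass_mono hb hle hf) hfm⟩
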